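/- Let $P\in\mathbb Z[\mathrm n]$ be a non-constant polynomial with integer coefficients, let $0<p\le\infty$, and let $\mathbb I\subseteq\mathbb Z_+=\{1,2,3,\dots\}$ be an infinite set. Then for every $C>0$ there exist a probability space $(X,\mu)$, an invertible bimeasurable measure-preserving map $T\colon X\to X$, and a function $f\in L^\infty(X)$ (complex-valued) with $\|f\|_{L^\infty(X)}\le 1$ such that $$\big\| (A_N^{P}f)_{N\in\mathbb I}\big\|_{L^p(X;V^2)}>C .$$ Here $A_N^{P}f(x)=\frac1N\sum_{n=1}^N f(T^{P(n)}x)$, and $\|(F_N)_{N\in\mathbb I}\|_{L^p(X;V^2)}$ denotes the $L^p(X)$ (quasi-)norm, with value in $[0,\infty]$, of the $2$-variation seminorm $$x\mapsto\sup_{J\in\mathbb Z_+}\ \sup_{\substack{t_0\le t_1\le\dots\le t_J\\ t_j\in\mathbb I}}\Big(\sum_{j=0}^{J-1}|F_{t_{j+1}}(x)-F_{t_j}(x)|^2\Big)^{1/2}.$$ -/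

import Mathlib

open MeasureTheory
open scoped ENNReal NNReal

noncomputable section

/-- The `r`-variation seminorm of a family `a` indexed by a totally ordered set `ι`, with values in
`[0, ∞]`: the supremum over all `J` and all finite sequences `t 0 ≤ t 1 ≤ ⋯ ≤ t J` in `ι` of
`(∑_{j < J} ‖a (t (j + 1)) - a (t j)‖ ^ r) ^ (1 / r)`. It is `0` if `ι` is empty. -/
def rVariation {ι B : Type*} [LinearOrder ι] [NormedAddCommGroup B] (r : ℝ) (a : ι → B) : ℝ≥0∞ :=
  ⨆ (J : ℕ) (t : Fin (J + 1) →o ι),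
    (∑ j : Fin J, ‖a (t j.succ) - a (t j.castSucc)‖ₑ ^ r) ^ (1 / r)

/-- The `L^p(X; V^r)` norm of a family `F` of functions on `X`: the `L^p` norm of the function
sending `x` to the `r`-variation seminorm of `N ↦ F N x`. -/
def eLpVariation {X ι B : Type*} [MeasurableSpace X] [LinearOrder ι] [NormedAddCommGroup B]
    (F : ι → X → B) (p : ℝ≥0∞) (r : ℝ) (μ : Measure X) : ℝ≥0∞ :=
  eLpNorm (fun x => rVariation r (fun N => F N x)) p μ

/-- The polynomial ergodic average `A_N f (x) = (1 / N) ∑_{n = 1}^{N} f (T ^ {P(n)} x)`, where `T` is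
invertible, so that negative values of `P(n)` are allowed. -/
def polyAverage {X : Type*} (T : Equiv.Perm X) (P : Polynomial ℤ) (f : X → ℂ) (N : ℕ+) (x : X) : ℂ :=
  (1 / ((N : ℕ) : ℂ)) * ∑ n ∈ Finset.Icc 1 (N : ℕ), f ((T ^ (P.eval (n : ℤ))) x)

end

/-! The exponent 2 fails because the squared 2-variation of a simple random walk of `J` steps is not
O(J): for any constant there are lengths `J` at which, with high probability, it exceeds that
multiple of `J` (`exists_blockVar_large`). To see this, cut a window into `B` equal blocks. With
probability at least 2^(-B) the block increments all have the same sign, and then the square of the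
single long increment beats the sum over the blocks. Each further scale thus adds a fixed amount to
the normalised mean, until a prescribed level is reached (`expect_blockVar_ge`). Chebyshev's
inequality over many independent windows turns the mean into a probability.

The walk itself is unbounded, so it is replaced by f = exp(iθ∑ε_j) with θ = J^(-1/2). Its
conditional expectations given ε_j, j ≥ i, namely `expMart θ i`, have modulus at most 1, and on
short windows their increments dominate θ/4 times those of the walk (`le_norm_expMart_sub`). Their
squared 2-variation is therefore still arbitrarily large.

These conditional expectations are realised approximately by polynomial averages. The space is a
long cycle times random signs, the j-th sign being constant on blocks of length M_j, with scales N_0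
≪ M_0 ≪ N_1 ≪ M_1 ≪ ⋯ and N_i in the given set; M_j also dominates |P(n)| for n ≤ N_j. In the
average of length N_i the signs with j ≥ i hardly change (`expect_polyAverage_sub_self`). Those with
j < i average out, since P takes each value at most deg P times and so visits many blocks
(`expect_polyAverage_odd`). Hence the average is close to `expMart θ i` in L²
(`expect_polyAverage_expMart`). A lower bound on half of the space suffices for every p
(`exists_finite_system`). -/

namespace ErgodicVariation

open Finset
open scoped BigOperators

/-! ### Signs and averages over the discrete cube -/

/-- Extension of a finite sequence of signs by `1`. -/
def signExt {J : ℕ} (x : Fin J → ℤˣ) (i : ℕ) : ℤˣ := if h : i < J then x ⟨i, h⟩ else 1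

/-- The `i`-th sign of `x`, as a real number. -/
def sgn {J : ℕ} (x : Fin J → ℤˣ) (i : ℕ) : ℝ := ((signExt x i : ℤ) : ℝ)

lemma sq_units_real (u : ℤˣ) : (((u : ℤ) : ℝ)) ^ 2 = 1 := by
  rcases Int.units_eq_one_or u with rfl | rfl <;> simp

lemma sgn_sq {J : ℕ} (x : Fin J → ℤˣ) (i : ℕ) : sgn x i ^ 2 = 1 := sq_units_real _

lemma abs_sgn {J : ℕ} (x : Fin J → ℤˣ) (i : ℕ) : |sgn x i| = 1 := by
  rw [← Real.sqrt_sq_eq_abs, sgn_sq, Real.sqrt_one]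

/-- Multiplication of a finite sequence of signs by an infinite one. -/
def flip {J : ℕ} (τ : ℕ → ℤˣ) (x : Fin J → ℤˣ) : Fin J → ℤˣ := fun i => τ i * x i

lemma sgn_flip {J : ℕ} (τ : ℕ → ℤˣ) (x : Fin J → ℤˣ) {i : ℕ} (hi : i < J) :
    sgn (flip τ x) i = ((τ i : ℤ) : ℝ) * sgn x i := by
  simp [sgn, signExt, flip, hi]

lemma expect_flip {J : ℕ} (τ : ℕ → ℤˣ) (f : (Fin J → ℤˣ) → ℝ) :
    𝔼 x, f (flip τ x) = 𝔼 x, f x :=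
  Fintype.expect_equiv (Equiv.mulLeft (fun i : Fin J => τ i)) _ _ (fun _ => rfl)

lemma expect_eq_zero_of_flip {J : ℕ} (τ : ℕ → ℤˣ) (f : (Fin J → ℤˣ) → ℝ)
    (h : ∀ x, f (flip τ x) = -f x) : 𝔼 x, f x = 0 := by
  have := expect_flip τ f
  simp only [h, expect_neg_distrib] at this
  linarith

/-- Functions of disjoint sets of coordinates are uncorrelated. -/
lemma expect_mul_of_disjoint {J : ℕ} (s : Set ℕ) (f g : (Fin J → ℤˣ) → ℝ)
    (hf : ∀ x y : Fin J → ℤˣ, (∀ i : Fin J, (i : ℕ) ∈ s → x i = y i) → f x = f y)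
    (hg : ∀ x y : Fin J → ℤˣ, (∀ i : Fin J, (i : ℕ) ∉ s → x i = y i) → g x = g y) :
    𝔼 x, f x * g x = (𝔼 x, f x) * 𝔼 x, g x := by
  classical
  let mix : (Fin J → ℤˣ) → (Fin J → ℤˣ) → (Fin J → ℤˣ) :=
    fun x y i => if (i : ℕ) ∈ s then x i else y i
  let Φ : ((Fin J → ℤˣ) × (Fin J → ℤˣ)) ≃ ((Fin J → ℤˣ) × (Fin J → ℤˣ)) :=
    { toFun := fun p => (mix p.1 p.2, mix p.2 p.1)
      invFun := fun p => (mix p.1 p.2, mix p.2 p.1)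
      left_inv := fun p => by
        refine Prod.ext ?_ ?_ <;> funext i <;> by_cases h : (i : ℕ) ∈ s <;> simp [mix, h]
      right_inv := fun p => by
        refine Prod.ext ?_ ?_ <;> funext i <;> by_cases h : (i : ℕ) ∈ s <;> simp [mix, h] }
  -- Exchanging the coordinates outside `s` between two independent copies preserves the uniform
  -- law, and turns the product over two copies into one over a single copy.
  have h1 : 𝔼 p : (Fin J → ℤˣ) × (Fin J → ℤˣ), f p.1 * g p.2 =
      𝔼 p : (Fin J → ℤˣ) × (Fin J → ℤˣ), f p.1 * g p.1 := by
    refine Fintype.expect_equiv Φ _ _ (fun p => ?_)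
    congr 1
    · exact hf _ _ (fun i hi => by simp [Φ, mix, hi])
    · exact hg _ _ (fun i hi => by simp [Φ, mix, hi])
  rw [← univ_product_univ, expect_product, expect_product] at h1
  simp only [Fintype.expect_const] at h1
  rw [← h1, expect_mul_expect]

/-! ### Moments of a simple random walk -/

/-- Induction on the length: terms odd in the newest sign have mean zero. The fourth moment serves
only to bound the first absolute moment from below. -/
lemma expect_walk_sq_and_four {J : ℕ} (a n : ℕ) (h : a + n ≤ J) :
    (𝔼 x : Fin J → ℤˣ, (∑ i ∈ Ico a (a + n), sgn x i) ^ 2 = n) ∧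
    (𝔼 x : Fin J → ℤˣ, (∑ i ∈ Ico a (a + n), sgn x i) ^ 4 ≤ 3 * (n : ℝ) ^ 2) := by
  induction n with
  | zero => simp
  | succ n ih =>
    obtain ⟨ih2, ih4⟩ := ih (by omega)
    set S : (Fin J → ℤˣ) → ℝ := fun x => ∑ i ∈ Ico a (a + n), sgn x i with hS
    have hstep : ∀ x : Fin J → ℤˣ,
        ∑ i ∈ Ico a (a + (n + 1)), sgn x i = S x + sgn x (a + n) := fun x => by
      rw [← add_assoc, sum_Ico_succ_top (by omega)]
    let τ : ℕ → ℤˣ := fun i => if i = a + n then -1 else 1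
    have hτS : ∀ x, S (flip τ x) = S x := fun x => by
      refine sum_congr rfl (fun i hi => ?_)
      rw [mem_Ico] at hi
      rw [sgn_flip _ _ (by omega)]
      simp only [τ, if_neg (show i ≠ a + n by omega)]
      simp
    have hτe : ∀ x : Fin J → ℤˣ, sgn (flip τ x) (a + n) = -sgn x (a + n) := fun x => by
      rw [sgn_flip _ _ (by omega)]; simp [τ]
    have o1 : 𝔼 x, S x * sgn x (a + n) = 0 :=
      expect_eq_zero_of_flip τ _ (fun x => by rw [hτS, hτe]; ring)
    have o3 : 𝔼 x, (S x ^ 3 * sgn x (a + n) + S x * sgn x (a + n)) = 0 :=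
      expect_eq_zero_of_flip τ _ (fun x => by rw [hτS, hτe]; ring)
    constructor
    · have : ∀ x : Fin J → ℤˣ, (∑ i ∈ Ico a (a + (n + 1)), sgn x i) ^ 2 =
          S x ^ 2 + 2 * (S x * sgn x (a + n)) + 1 := fun x => by
        rw [hstep, ← sgn_sq x (a + n)]; ring
      simp only [this]
      rw [expect_add_distrib, expect_add_distrib, ← mul_expect, o1, ih2, Fintype.expect_const]
      push_cast; ring
    · have : ∀ x : Fin J → ℤˣ, (∑ i ∈ Ico a (a + (n + 1)), sgn x i) ^ 4 =
          S x ^ 4 + 4 * (S x ^ 3 * sgn x (a + n) + S x * sgn x (a + n)) + 6 * S x ^ 2 + 1 :=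
        fun x => by
        rw [hstep]
        have := sgn_sq x (a + n)
        linear_combination (6 * S x ^ 2 + sgn x (a + n) ^ 2 + 1 + 4 * S x * sgn x (a + n)) * this
      simp only [this]
      rw [expect_add_distrib, expect_add_distrib, expect_add_distrib, ← mul_expect, ← mul_expect,
        o3, ih2, Fintype.expect_const]
      push_cast
      nlinarith

lemma le_expect_abs_walk {J : ℕ} (a n : ℕ) (h : a + n ≤ J) :
    Real.sqrt n / 2 ≤ 𝔼 x : Fin J → ℤˣ, |∑ i ∈ Ico a (a + n), sgn x i| := by
  obtain ⟨h2, h4⟩ := expect_walk_sq_and_four a n h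
  rcases Nat.eq_zero_or_pos n with rfl | hn
  · simp
  set r := Real.sqrt n with hr
  have hr0 : 0 < r := Real.sqrt_pos.2 (by exact_mod_cast hn)
  have hrr : r ^ 2 = n := Real.sq_sqrt (by positivity)
  -- This minorant of |y| touches it at |y| = 2r. With the two moments its mean is at least (3/4 -
  -- 3/16) r = 9r/16.
  have key : ∀ y : ℝ, 3 / (4 * r) * y ^ 2 - 1 / (16 * r ^ 3) * y ^ 4 ≤ |y| := fun y => by
    have hy : y ^ 2 = |y| ^ 2 := (sq_abs y).symm
    have hy4 : y ^ 4 = |y| ^ 4 := by rw [show y ^ 4 = (y ^ 2) ^ 2 by ring, hy]; ring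
    rw [hy, hy4]
    set t := |y|
    have ht : 0 ≤ t := abs_nonneg y
    have : 0 ≤ t * ((t - 2 * r) ^ 2 * (t + 4 * r)) / (16 * r ^ 3) := by positivity
    have e : t * ((t - 2 * r) ^ 2 * (t + 4 * r)) / (16 * r ^ 3) =
        t - (3 / (4 * r) * t ^ 2 - 1 / (16 * r ^ 3) * t ^ 4) := by
      field_simp; ring
    linarith
  have := expect_le_expect (s := (univ : Finset (Fin J → ℤˣ)))
    (fun x _ => key (∑ i ∈ Ico a (a + n), sgn x i))
  rw [expect_sub_distrib, ← mul_expect, ← mul_expect, h2] at this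
  refine le_trans ?_ this
  have h5 : 1 / (16 * r ^ 3) * (𝔼 x : Fin J → ℤˣ, (∑ i ∈ Ico a (a + n), sgn x i) ^ 4) ≤
      1 / (16 * r ^ 3) * (3 * (n : ℝ) ^ 2) := by gcongr
  rw [← hrr] at h5 ⊢
  have e1 : 3 / (4 * r) * r ^ 2 = 3 / 4 * r := by field_simp
  have e2 : 1 / (16 * r ^ 3) * (3 * (r ^ 2) ^ 2) = 3 / 16 * r := by field_simp
  rw [e2] at h5
  rw [e1]
  linarith

/-! ### A hierarchical lower bound for the quadratic variation -/

/-- A lower bound for the square of the `2`-variation of the path with steps `e` over the window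
`[a, a + B ^ k]`, defined by recursion over `B`-adic subdivisions. -/
def blockVar (B : ℕ) (e : ℕ → ℝ) : ℕ → ℕ → ℝ
  | 0, a => e a ^ 2
  | k + 1, a => max (∑ i ∈ range B, blockVar B e k (a + i * B ^ k))
      ((∑ i ∈ Ico a (a + B ^ (k + 1)), e i) ^ 2)

lemma blockVar_nonneg (B : ℕ) (e : ℕ → ℝ) (k a : ℕ) : 0 ≤ blockVar B e k a := by
  cases k with
  | zero => exact sq_nonneg _
  | succ k => exact le_max_of_le_right (sq_nonneg _)

lemma sub_window {B k i : ℕ} (hi : i < B) : i * B ^ k + B ^ k ≤ B ^ (k + 1) := by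
  calc i * B ^ k + B ^ k = (i + 1) * B ^ k := by ring
    _ ≤ B * B ^ k := Nat.mul_le_mul_right _ hi
    _ = B ^ (k + 1) := by ring

lemma sum_Ico_windows (e : ℕ → ℝ) (a l n : ℕ) :
    ∑ i ∈ Ico a (a + n * l), e i =
      ∑ j ∈ range n, ∑ i ∈ Ico (a + j * l) (a + j * l + l), e i := by
  induction n with
  | zero => simp
  | succ n ih =>
    rw [sum_range_succ, ← ih, sum_Ico_consecutive _ (by omega) (by omega)]
    congr 2; ring

lemma blockVar_le {B : ℕ} (hB : 0 < B) (e : ℕ → ℝ) (he : ∀ i, |e i| = 1) (k a : ℕ) :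
    blockVar B e k a ≤ ((B : ℝ) ^ k) ^ 2 := by
  have hB' : (1 : ℝ) ≤ B := by exact_mod_cast hB
  induction k generalizing a with
  | zero => simp [blockVar, ← sq_abs (e a), he]
  | succ k ih =>
    refine max_le ?_ ?_
    · refine (sum_le_sum (fun i _ => ih _)).trans ?_
      rw [sum_const, card_range, nsmul_eq_mul, pow_succ (B : ℝ) k, mul_pow]
      rw [mul_comm (B : ℝ)]
      exact mul_le_mul_of_nonneg_left (by nlinarith) (by positivity)
    · rw [← sq_abs]
      gcongr
      refine (abs_sum_le_sum_abs _ _).trans ?_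
      simp [he]

/-- Changing the sign of all steps in the window does not change the block variation. -/
lemma blockVar_congr_sign {B : ℕ} (e e' : ℕ → ℝ) (s : ℝ) (hs : s ^ 2 = 1) (k a : ℕ)
    (h : ∀ i ∈ Ico a (a + B ^ k), e' i = s * e i) : blockVar B e' k a = blockVar B e k a := by
  induction k generalizing a with
  | zero => simp [blockVar, h a (by simp), mul_pow, hs]
  | succ k ih =>
    simp only [blockVar]
    congr 1
    · refine sum_congr rfl (fun i hi => ih _ (fun j hj => h j ?_))
      have := sub_window (k := k) (mem_range.1 hi)
      rw [mem_Ico] at hj ⊢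
      omega
    · rw [sum_congr rfl h, ← mul_sum, mul_pow, hs, one_mul]

/-- One step of the recursion: flipping the signs of the blocks increases the mean. -/
lemma expect_blockVar_succ {J B : ℕ} (hB : 0 < B) (k a : ℕ) (h : a + B ^ (k + 1) ≤ J) :
    (∑ i ∈ range B, 𝔼 x : Fin J → ℤˣ, blockVar B (sgn x) k (a + i * B ^ k)) +
      (1 / 2) ^ B * ((B * (Real.sqrt (B ^ k) / 2)) ^ 2 -
        ∑ i ∈ range B, 𝔼 x : Fin J → ℤˣ, blockVar B (sgn x) k (a + i * B ^ k)) ≤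
      𝔼 x : Fin J → ℤˣ, blockVar B (sgn x) (k + 1) a := by
  set W : (Fin J → ℤˣ) → ℝ := fun x => ∑ i ∈ range B, blockVar B (sgn x) k (a + i * B ^ k) with hW
  set D : ℕ → (Fin J → ℤˣ) → ℝ :=
    fun i x => ∑ j ∈ Ico (a + i * B ^ k) (a + i * B ^ k + B ^ k), sgn x j with hD
  have hEW : ∑ i ∈ range B, 𝔼 x : Fin J → ℤˣ, blockVar B (sgn x) k (a + i * B ^ k) = 𝔼 x, W x := by
    rw [hW, expect_sum_comm]
  have hBk : 0 < B ^ k := Nat.pow_pos hB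
  -- `τ σ` multiplies the whole i-th block by σ_i. This preserves the law of the walk and every
  -- block variation, so the mean can also be averaged over σ.
  let τ : (Fin B → ℤˣ) → ℕ → ℤˣ := fun σ j => signExt σ ((j - a) / B ^ k)
  have hτ : ∀ σ x i, i < B → ∀ j ∈ Ico (a + i * B ^ k) (a + i * B ^ k + B ^ k),
      sgn (flip (τ σ) x : Fin J → ℤˣ) j = sgn σ i * sgn x j := by
    intro σ x i hi j hj
    have h2 := sub_window (k := k) hi
    rw [mem_Ico] at hj
    rw [sgn_flip _ _ (by omega)]
    have : (j - a) / B ^ k = i := by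
      rw [Nat.div_eq_iff hBk]
      omega
    simp only [τ, this]; rfl
  have hD' : ∀ σ x i, i < B → D i (flip (τ σ) x) = sgn σ i * D i x := fun σ x i hi => by
    simp only [hD]
    rw [sum_congr rfl (hτ σ x i hi), mul_sum]
  have hW' : ∀ σ x, W (flip (τ σ) x) = W x := fun σ x =>
    sum_congr rfl (fun i hi => blockVar_congr_sign _ _ (sgn σ i) (sgn_sq _ _) _ _
      (hτ σ x i (mem_range.1 hi)))
  have hinc : ∀ x : Fin J → ℤˣ, ∑ i ∈ Ico a (a + B ^ (k + 1)), sgn x i = ∑ i ∈ range B, D i x :=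
    fun x => by rw [pow_succ', sum_Ico_windows]
  have hmean : ∀ σ : Fin B → ℤˣ, 𝔼 x : Fin J → ℤˣ, blockVar B (sgn x) (k + 1) a =
      𝔼 x, max (W x) ((∑ i ∈ range B, sgn σ i * D i x) ^ 2) := fun σ => by
    rw [← expect_flip (τ σ)]
    refine expect_congr rfl (fun x _ => ?_)
    simp only [blockVar]
    rw [hinc, ← hW' σ x]
    congr 2
    exact sum_congr rfl (fun i hi => hD' σ x i (mem_range.1 hi))
  have hcard : (Fintype.card (Fin B → ℤˣ) : ℝ) = 2 ^ B := by simp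
  have havg : 𝔼 x : Fin J → ℤˣ, blockVar B (sgn x) (k + 1) a =
      𝔼 x, 𝔼 σ : Fin B → ℤˣ, max (W x) ((∑ i ∈ range B, sgn σ i * D i x) ^ 2) := by
    rw [expect_comm, expect_congr rfl (fun σ _ => (hmean σ).symm), Fintype.expect_const]
  have hpt : ∀ x : Fin J → ℤˣ, W x + (1 / 2) ^ B * ((∑ i ∈ range B, |D i x|) ^ 2 - W x) ≤
      𝔼 σ : Fin B → ℤˣ, max (W x) ((∑ i ∈ range B, sgn σ i * D i x) ^ 2) := fun x => by
    let σ₀ : Fin B → ℤˣ := fun i => if 0 ≤ D i x then 1 else -1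
    have h0 : ∑ i ∈ range B, sgn σ₀ i * D i x = ∑ i ∈ range B, |D i x| := by
      refine sum_congr rfl (fun i hi => ?_)
      rw [mem_range] at hi
      by_cases hd : 0 ≤ D i x
      · simp [sgn, signExt, hi, σ₀, hd, abs_of_nonneg hd]
      · simp [sgn, signExt, hi, σ₀, hd, abs_of_neg (not_le.1 hd)]
    have h1 : (∑ i ∈ range B, |D i x|) ^ 2 - W x ≤
        ∑ σ : Fin B → ℤˣ, (max (W x) ((∑ i ∈ range B, sgn σ i * D i x) ^ 2) - W x) := by
      refine le_trans ?_ (single_le_sum (f := fun σ : Fin B → ℤˣ =>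
        max (W x) ((∑ i ∈ range B, sgn σ i * D i x) ^ 2) - W x)
        (fun σ _ => sub_nonneg.2 (le_max_left _ _)) (mem_univ σ₀))
      simp only [h0]
      gcongr
      exact le_max_right _ _
    rw [sum_sub_distrib, sum_const, card_univ, nsmul_eq_mul, hcard] at h1
    rw [Fintype.expect_eq_sum_div_card, hcard, le_div_iff₀ (by positivity)]
    have : ((1 : ℝ) / 2) ^ B * 2 ^ B = 1 := by rw [← mul_pow]; norm_num
    linear_combination h1 + ((∑ i ∈ range B, |D i x|) ^ 2 - W x) * this
  have hE := expect_le_expect (s := (univ : Finset (Fin J → ℤˣ))) (fun x _ => hpt x)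
  rw [← havg, expect_add_distrib, ← mul_expect, expect_sub_distrib] at hE
  rw [hEW]
  refine le_trans ?_ hE
  gcongr
  have habs : B * (Real.sqrt (B ^ k) / 2) ≤ 𝔼 x, ∑ i ∈ range B, |D i x| := by
    rw [expect_sum_comm]
    have : ∀ i ∈ range B, Real.sqrt (B ^ k) / 2 ≤ 𝔼 x, |D i x| := fun i hi => by
      have := sub_window (k := k) (mem_range.1 hi)
      have := le_expect_abs_walk (J := J) (a + i * B ^ k) (B ^ k) (by omega)
      simpa using this
    calc _ = ∑ i ∈ range B, Real.sqrt (B ^ k) / 2 := by simp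
      _ ≤ _ := sum_le_sum this
  have hCS := expect_mul_sq_le_sq_mul_sq (univ : Finset (Fin J → ℤˣ))
    (fun x => ∑ i ∈ range B, |D i x|) (fun _ => 1)
  simp only [mul_one, one_pow, Fintype.expect_const] at hCS
  refine le_trans ?_ hCS
  gcongr

/-- With B = 4(C+1) the aligned increment has mean square at least (C+1)B^(k+1). While the mean over
the blocks is below C·B^(k+1), the gap is at least B^(k+1), and a proportion 2^(-B) of it is gained
at each scale. -/
lemma expect_blockVar_ge {J : ℕ} (C : ℕ) (k a : ℕ) (h : a + (4 * (C + 1)) ^ k ≤ J) :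
    min (C : ℝ) (k * (1 / 2) ^ (4 * (C + 1))) * ((4 * (C + 1) : ℕ) : ℝ) ^ k ≤
      𝔼 x : Fin J → ℤˣ, blockVar (4 * (C + 1)) (sgn x) k a := by
  set B := 4 * (C + 1) with hB
  induction k generalizing a with
  | zero =>
    simp only [CharP.cast_eq_zero, zero_mul, pow_zero, mul_one]
    exact (min_le_right _ _).trans (expect_nonneg fun x _ => blockVar_nonneg _ _ _ _)
  | succ k ih =>
    have hstep := expect_blockVar_succ (J := J) (B := B) (by omega) k a h
    set w := ∑ i ∈ range B, 𝔼 x : Fin J → ℤˣ, blockVar B (sgn x) k (a + i * B ^ k) with hw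
    have hw1 : min (C : ℝ) (k * (1 / 2) ^ B) * (B : ℝ) ^ (k + 1) ≤ w := by
      have : ∀ i ∈ range B, min (C : ℝ) (k * (1 / 2) ^ B) * (B : ℝ) ^ k ≤
          𝔼 x : Fin J → ℤˣ, blockVar B (sgn x) k (a + i * B ^ k) := fun i hi => by
        have := sub_window (k := k) (mem_range.1 hi)
        exact ih _ (by omega)
      refine le_trans (le_of_eq ?_) (sum_le_sum this)
      rw [sum_const, card_range, nsmul_eq_mul]; ring
    have hδ : (0 : ℝ) < (1 / 2) ^ B := by positivity
    have hδ1 : ((1 : ℝ) / 2) ^ B ≤ 1 := pow_le_one₀ (by norm_num) (by norm_num)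
    have hP : (0 : ℝ) < (B : ℝ) ^ (k + 1) := by positivity
    have hsq : (B * (Real.sqrt (B ^ k) / 2)) ^ 2 = (C + 1) * (B : ℝ) ^ (k + 1) := by
      rw [mul_pow, div_pow, Real.sq_sqrt (by positivity)]
      have : (B : ℝ) = 4 * (C + 1) := by rw [hB]; push_cast; ring
      rw [pow_succ (B : ℝ) k]
      linear_combination (B : ℝ) * (B : ℝ) ^ k / 4 * this
    rw [hsq] at hstep
    rcases le_or_gt ((C : ℝ) * (B : ℝ) ^ (k + 1)) w with hc | hc
    · have h1 : (C : ℝ) * (B : ℝ) ^ (k + 1) ≤ 𝔼 x : Fin J → ℤˣ, blockVar B (sgn x) (k + 1) a := by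
        refine le_trans ?_ hstep
        nlinarith
      refine le_trans ?_ h1
      gcongr
      exact min_le_left _ _
    · have hm : min (C : ℝ) (k * (1 / 2) ^ B) = k * (1 / 2) ^ B := by
        refine min_eq_right (le_of_not_gt fun hlt => ?_)
        rw [min_eq_left hlt.le] at hw1
        linarith
      rw [hm] at hw1
      refine le_trans ?_ hstep
      refine le_trans (mul_le_mul_of_nonneg_right (min_le_right _ _) hP.le) ?_
      push_cast
      have : (1 / 2 : ℝ) ^ B * (B : ℝ) ^ (k + 1) ≤
          (1 / 2) ^ B * ((C + 1) * (B : ℝ) ^ (k + 1) - w) := by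
        gcongr; linarith
      linarith

/-- With high probability the total block variation of many independent windows is large. -/
lemma exists_blockVar_large (C : ℕ) : ∃ B k : ℕ, 0 < B ∧ ∀ m : ℕ, 4 * (B ^ k) ^ 2 ≤ m →
    𝔼 x : Fin (m * B ^ k) → ℤˣ, (if ∑ i ∈ range m, blockVar B (sgn x) k (i * B ^ k) <
      C * (m * B ^ k : ℕ) then (1 : ℝ) else 0) ≤ 1 / 4 := by
  -- The means are pushed up to the level C + 1, so that a total below C·J is a deviation of at
  -- least J from the mean.
  set B := 4 * ((C + 1) + 1) with hB
  obtain ⟨k, hk⟩ := exists_nat_ge ((C + 1 : ℝ) * 2 ^ B)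
  refine ⟨B, k, by omega, fun m hm => ?_⟩
  set l := B ^ k with hl
  have hl0 : 0 < l := Nat.pow_pos (by omega)
  set J := m * l with hJ
  have hm0 : 0 < m := lt_of_lt_of_le (by positivity) hm
  set W : ℕ → (Fin J → ℤˣ) → ℝ := fun i x => blockVar B (sgn x) k (i * l) with hW
  have hwin : ∀ i ∈ range m, i * l + l ≤ J := fun i hi => by
    calc i * l + l = (i + 1) * l := by ring
      _ ≤ m * l := Nat.mul_le_mul_right _ (mem_range.1 hi)
  have hEW : ∀ i ∈ range m, (C + 1 : ℝ) * l ≤ 𝔼 x, W i x := fun i hi => by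
    have := expect_blockVar_ge (J := J) (C + 1) k (i * l) (hwin i hi)
    refine le_trans (le_of_eq ?_) this
    rw [min_eq_left]
    · rw [hl, hB]; push_cast; rfl
    · push_cast
      rw [one_div, inv_pow, ← div_eq_mul_inv, le_div_iff₀ (by positivity)]
      exact hk
  have hW0 : ∀ i x, 0 ≤ W i x := fun i x => blockVar_nonneg _ _ _ _
  have hW1 : ∀ i x, W i x ≤ (l : ℝ) ^ 2 := fun i x => by
    have := blockVar_le (B := B) (by omega) (sgn x) (abs_sgn x) k (i * l)
    simpa [hl] using this
  set Y : ℕ → (Fin J → ℤˣ) → ℝ := fun i x => W i x - 𝔼 y, W i y with hY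
  have hY2 : ∀ i x, Y i x ^ 2 ≤ (l : ℝ) ^ 4 := fun i x => by
    have h1 : 𝔼 y, W i y ≤ (l : ℝ) ^ 2 := expect_le univ_nonempty (fun y _ => hW1 i y)
    have h2 : 0 ≤ 𝔼 y, W i y := expect_nonneg (fun y _ => hW0 i y)
    have h3 : |Y i x| ≤ (l : ℝ) ^ 2 := abs_le.2
      ⟨by simp only [hY]; linarith [hW0 i x], by simp only [hY]; linarith [hW1 i x]⟩
    rw [← sq_abs, show (l : ℝ) ^ 4 = ((l : ℝ) ^ 2) ^ 2 by ring]
    gcongr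
  have hYE : ∀ i, 𝔼 x, Y i x = 0 := fun i => by
    simp only [hY]
    rw [expect_sub_distrib, Fintype.expect_const, sub_self]
  have hdep : ∀ i, ∀ x y : Fin J → ℤˣ, (∀ j : Fin J, (j : ℕ) ∈ Set.Ico (i * l) (i * l + l) →
      x j = y j) → Y i x = Y i y := fun i x y hxy => by
    simp only [hY, hW]
    rw [blockVar_congr_sign (sgn y) (sgn x) 1 (by norm_num)]
    intro j hj
    by_cases hjJ : j < J
    · have := hxy ⟨j, hjJ⟩ (by simpa [hl] using hj)
      simp [sgn, signExt, hjJ, this]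
    · simp [sgn, signExt, hjJ]
  have hcov : ∀ i j, i ≠ j → 𝔼 x, Y i x * Y j x = 0 := fun i j hij => by
    rw [expect_mul_of_disjoint (Set.Ico (i * l) (i * l + l)) _ _ (hdep i), hYE, zero_mul]
    refine fun x y hxy => hdep j x y (fun t ht => hxy t (fun ht' => hij ?_))
    rw [Set.mem_Ico] at ht ht'
    have e1 : (t : ℕ) / l = i := by
      rw [Nat.div_eq_iff hl0]; omega
    have e2 : (t : ℕ) / l = j := by
      rw [Nat.div_eq_iff hl0]; omega
    omega
  have hvar : 𝔼 x, (∑ i ∈ range m, Y i x) ^ 2 ≤ m * (l : ℝ) ^ 4 := by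
    simp only [sq, sum_mul_sum]
    rw [expect_sum_comm]
    have : ∀ i ∈ range m, 𝔼 x, ∑ j ∈ range m, Y i x * Y j x ≤ (l : ℝ) ^ 4 := fun i hi => by
      rw [expect_sum_comm, sum_eq_single_of_mem i hi (fun j _ hj => hcov i j hj.symm)]
      exact expect_le univ_nonempty (fun x _ => by rw [← sq]; exact hY2 i x)
    refine (sum_le_sum this).trans (by simp)
  have hJr : (J : ℝ) = m * l := by rw [hJ]; push_cast; ring
  have hJ0 : (0 : ℝ) < J := by rw [hJr]; positivity
  have hpt : ∀ x : Fin J → ℤˣ, (if ∑ i ∈ range m, W i x < C * (J : ℕ) then (1 : ℝ) else 0) ≤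
      (1 / (J : ℝ) ^ 2) * (∑ i ∈ range m, Y i x) ^ 2 := fun x => by
    split_ifs with hx
    · have h1 : (C + 1 : ℝ) * J ≤ ∑ i ∈ range m, 𝔼 y, W i y := by
        refine le_trans (le_of_eq ?_) (sum_le_sum hEW)
        rw [sum_const, card_range, nsmul_eq_mul, hJr]; ring
      have h2 : ∑ i ∈ range m, Y i x ≤ -J := by
        simp only [hY, sum_sub_distrib]; linarith
      rw [one_div_mul_eq_div, le_div_iff₀ (by positivity)]
      nlinarith
    · positivity
  -- Chebyshev: the variance is at most m·l⁴ and J = m·l, so the probability is at most l²/m.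
  refine (expect_le_expect (fun x _ => hpt x)).trans ?_
  rw [← mul_expect]
  calc 1 / (J : ℝ) ^ 2 * 𝔼 x, (∑ i ∈ range m, Y i x) ^ 2
      ≤ 1 / (J : ℝ) ^ 2 * (m * (l : ℝ) ^ 4) := by gcongr
    _ = (l : ℝ) ^ 2 / m := by rw [hJr]; field_simp
    _ ≤ 1 / 4 := by
      rw [div_le_iff₀ (by positivity)]
      have : (4 * (l : ℝ) ^ 2) ≤ m := by exact_mod_cast hm
      linarith

/-! ### Partitions and variation -/

/-- `v` is the sum of `d (t j) (t (j + 1))` over some partition `a = t 0 ≤ ⋯ ≤ t n = b`. -/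
inductive IsPartitionSum (d : ℕ → ℕ → ℝ) : ℕ → ℕ → ℝ → Prop
  | refl (a : ℕ) : IsPartitionSum d a a 0
  | snoc {a b c : ℕ} {v : ℝ} (h : IsPartitionSum d a b v) (hbc : b ≤ c) :
      IsPartitionSum d a c (v + d b c)

lemma IsPartitionSum.trans {d : ℕ → ℕ → ℝ} {a b c : ℕ} {v w : ℝ} (h : IsPartitionSum d a b v)
    (h' : IsPartitionSum d b c w) : IsPartitionSum d a c (v + w) := by
  induction h' with
  | refl => simpa using h
  | snoc _ hbc ih => rw [← add_assoc]; exact ih.snoc hbc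

lemma IsPartitionSum.single {d : ℕ → ℕ → ℝ} {a b : ℕ} (h : a ≤ b) :
    IsPartitionSum d a b (d a b) := by
  simpa using (IsPartitionSum.refl (d := d) a).snoc h

lemma IsPartitionSum.exists_monotone {d : ℕ → ℕ → ℝ} {a b : ℕ} {v : ℝ}
    (h : IsPartitionSum d a b v) : ∃ (n : ℕ) (t : ℕ → ℕ), Monotone t ∧ (∀ i, n ≤ i → t i = b) ∧
      ∑ j ∈ range n, d (t j) (t (j + 1)) = v := by
  induction h with
  | refl => exact ⟨0, fun _ => a, monotone_const, fun _ _ => rfl, by simp⟩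
  | @snoc b c v _ hbc ih =>
    obtain ⟨n, t, ht, htb, hv⟩ := ih
    have hle : ∀ i, t i ≤ b := fun i => by
      rw [← htb (max n i) (le_max_left _ _)]
      exact ht (le_max_right _ _)
    refine ⟨n + 1, fun i => if i ≤ n then t i else c, fun i j hij => ?_, fun i hi => ?_, ?_⟩
    · dsimp only
      split_ifs with h1 h2
      · exact ht hij
      · exact (hle i).trans hbc
      · omega
      · exact le_rfl
    · simp [(show ¬ i ≤ n by omega)]
    · rw [sum_range_succ, ← hv]
      congr 1
      · refine sum_congr rfl (fun i hi => ?_)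
        rw [mem_range] at hi
        simp [hi.le, Nat.succ_le_of_lt hi]
      · simp [htb n le_rfl]

lemma ofReal_sqrt_le_rVariation {ι : Type*} [LinearOrder ι] (F : ι → ℂ) (N : ℕ → ι)
    (hN : Monotone N) {a b : ℕ} {v : ℝ}
    (h : IsPartitionSum (fun s t => ‖F (N t) - F (N s)‖ ^ 2) a b v) :
    ENNReal.ofReal (Real.sqrt v) ≤ rVariation 2 F := by
  obtain ⟨n, t, ht, -, hv⟩ := h.exists_monotone
  let t' : Fin (n + 1) →o ι := ⟨fun j => N (t j), fun i j hij => hN (ht hij)⟩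
  refine le_trans (le_of_eq ?_) (le_iSup₂ (f := fun (J : ℕ) (t : Fin (J + 1) →o ι) =>
    (∑ j : Fin J, ‖F (t j.succ) - F (t j.castSucc)‖ₑ ^ (2 : ℝ)) ^ (1 / (2 : ℝ))) n t')
  have h1 : ∑ j : Fin n, ‖F (t' j.succ) - F (t' j.castSucc)‖ₑ ^ (2 : ℝ) = ENNReal.ofReal v := by
    rw [← hv, ← Fin.sum_univ_eq_sum_range (fun j => ‖F (N (t (j + 1))) - F (N (t j))‖ ^ 2),
      ENNReal.ofReal_sum_of_nonneg (fun _ _ => by positivity)]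
    refine sum_congr rfl (fun j _ => ?_)
    rw [ENNReal.ofReal_pow (norm_nonneg _), ofReal_norm]
    norm_cast
  have hv0 : 0 ≤ v := by rw [← hv]; exact sum_nonneg (fun _ _ => by positivity)
  rw [h1, Real.sqrt_eq_rpow, ENNReal.ofReal_rpow_of_nonneg hv0 (by norm_num)]

lemma exists_isPartitionSum_windows {d : ℕ → ℕ → ℝ} (w : ℕ → ℝ) (a l n : ℕ)
    (h : ∀ i < n, ∃ v, IsPartitionSum d (a + i * l) (a + i * l + l) v ∧ w i ≤ v) :
    ∃ v, IsPartitionSum d a (a + n * l) v ∧ ∑ i ∈ range n, w i ≤ v := by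
  induction n with
  | zero => exact ⟨0, by simpa using IsPartitionSum.refl a, by simp⟩
  | succ n ih =>
    obtain ⟨v, hv, hle⟩ := ih (fun i hi => h i (by omega))
    obtain ⟨v', hv', hle'⟩ := h n (by omega)
    refine ⟨v + v', ?_, ?_⟩
    · have := hv.trans hv'
      rwa [show a + n * l + l = a + (n + 1) * l by ring] at this
    · rw [sum_range_succ]; linarith

/-- The partition is read off from which argument attains each maximum in `blockVar`. The comparison
with `d` is required only inside the window, because the martingale follows the walk only on short
windows. -/
lemma exists_isPartitionSum_blockVar {B : ℕ} {d : ℕ → ℕ → ℝ} {κ : ℝ} (e : ℕ → ℝ)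
    (k a : ℕ) (h : ∀ s t, a ≤ s → s ≤ t → t ≤ a + B ^ k → κ * (∑ i ∈ Ico s t, e i) ^ 2 ≤ d s t) :
    ∃ v, IsPartitionSum d a (a + B ^ k) v ∧ κ * blockVar B e k a ≤ v := by
  induction k generalizing a with
  | zero =>
    refine ⟨d a (a + 1), IsPartitionSum.single (by omega), ?_⟩
    simpa [blockVar] using h a (a + 1) le_rfl (by omega) (by simp)
  | succ k ih =>
    rw [blockVar]
    rcases le_total (∑ i ∈ range B, blockVar B e k (a + i * B ^ k))
      ((∑ i ∈ Ico a (a + B ^ (k + 1)), e i) ^ 2) with hm | hm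
    · rw [max_eq_right hm]
      exact ⟨_, IsPartitionSum.single (by omega), h _ _ le_rfl (by omega) le_rfl⟩
    · rw [max_eq_left hm, mul_sum, pow_succ']
      refine exists_isPartitionSum_windows _ a (B ^ k) B (fun i hi => ih _ fun s t hs hst ht => ?_)
      have := sub_window (k := k) hi
      exact h s t (by omega) hst (by omega)

/-! ### The exponential martingale -/

/-- The conditional expectation of `exp (iθ ∑_j ε_j)` given the signs `ε_j`, `j ≥ i`. -/
noncomputable def expMart {J : ℕ} (θ : ℝ) (i : ℕ) (x : Fin J → ℤˣ) : ℂ :=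
  ((Real.cos θ : ℝ) : ℂ) ^ i * Complex.exp ((θ * ∑ j ∈ Ico i J, sgn x j : ℝ) * Complex.I)

lemma norm_expMart {J : ℕ} (θ : ℝ) (i : ℕ) (x : Fin J → ℤˣ) :
    ‖expMart θ i x‖ = |Real.cos θ| ^ i := by
  rw [expMart, norm_mul, Complex.norm_exp_ofReal_mul_I, mul_one, norm_pow, Complex.norm_real,
    Real.norm_eq_abs]

lemma norm_expMart_le {J : ℕ} (θ : ℝ) (i : ℕ) (x : Fin J → ℤˣ) : ‖expMart θ i x‖ ≤ 1 := by
  rw [norm_expMart]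
  exact pow_le_one₀ (abs_nonneg _) (Real.abs_cos_le_one θ)

lemma expMart_congr {J : ℕ} (θ : ℝ) (i : ℕ) (x y : Fin J → ℤˣ)
    (h : ∀ j : Fin J, i ≤ j → x j = y j) : expMart θ i x = expMart θ i y := by
  have : ∑ j ∈ Ico i J, sgn x j = ∑ j ∈ Ico i J, sgn y j := by
    refine sum_congr rfl (fun j hj => ?_)
    rw [mem_Ico] at hj
    simp [sgn, signExt, hj.2, h ⟨j, hj.2⟩ hj.1]
  rw [expMart, expMart, this]

lemma expMart_sub_succ {J : ℕ} (θ : ℝ) {i : ℕ} (hi : i < J) (x : Fin J → ℤˣ) :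
    expMart θ i x - expMart θ (i + 1) x = sgn x i * (((Real.cos θ : ℝ) : ℂ) ^ i *
      Complex.exp ((θ * ∑ j ∈ Ico (i + 1) J, sgn x j : ℝ) * Complex.I) *
        ((Real.sin θ : ℝ) * Complex.I)) := by
  rw [expMart, expMart, sum_eq_sum_Ico_succ_bot hi, mul_add, Complex.ofReal_add, add_mul,
    Complex.exp_add]
  have : Complex.exp ((θ * sgn x i : ℝ) * Complex.I) =
      Real.cos θ + sgn x i * (Real.sin θ * Complex.I) := by
    rw [Complex.exp_mul_I, ← Complex.ofReal_cos, ← Complex.ofReal_sin]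
    rcases Int.units_eq_one_or (signExt x i) with h | h <;> simp [sgn, h]
  rw [this]; ring

/-- The martingale differences are odd in the sign that is integrated out; this oddness makes their
long averages small. -/
lemma expMart_sub_succ_flip {J : ℕ} (θ : ℝ) {i : ℕ} (hi : i < J) (x y : Fin J → ℤˣ)
    (h : ∀ j : Fin J, (j : ℕ) ≠ i → x j = y j) (hn : x ⟨i, hi⟩ = -y ⟨i, hi⟩) :
    expMart θ i x - expMart θ (i + 1) x = -(expMart θ i y - expMart θ (i + 1) y) := by
  rw [expMart_sub_succ θ hi, expMart_sub_succ θ hi]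
  have h1 : ∑ j ∈ Ico (i + 1) J, sgn x j = ∑ j ∈ Ico (i + 1) J, sgn y j := by
    refine sum_congr rfl (fun j hj => ?_)
    rw [mem_Ico] at hj
    simp [sgn, signExt, hj.2, h ⟨j, hj.2⟩ (by simp; omega)]
  have h2 : sgn x i = -sgn y i := by simp [sgn, signExt, hi, hn]
  rw [h1, h2]; push_cast; ring

/-- The difference of the squares is (u - w)(u + w - 2w Re z) ≥ 0. Hence the change of the damping
factor from cos^t to cos^s cannot cancel the oscillation. -/
lemma mul_norm_sub_one_le {u w : ℝ} (hw : 0 ≤ w) (hwu : w ≤ u) {z : ℂ} (hz : ‖z‖ = 1) :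
    w * ‖z - 1‖ ≤ ‖(u : ℂ) * z - w‖ := by
  have h1 : z.re * z.re + z.im * z.im = 1 := by
    rw [← Complex.normSq_apply, Complex.normSq_eq_norm_sq, hz, one_pow]
  have h2 : z.re ≤ 1 := by nlinarith [mul_self_nonneg z.im]
  refine (abs_le_of_sq_le_sq' ?_ (norm_nonneg _)).2
  rw [mul_pow, ← Complex.normSq_eq_norm_sq, ← Complex.normSq_eq_norm_sq, Complex.normSq_apply,
    Complex.normSq_apply]
  simp only [Complex.sub_re, Complex.sub_im, Complex.one_re, Complex.one_im, Complex.re_ofReal_mul,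
    Complex.im_ofReal_mul, Complex.ofReal_re, Complex.ofReal_im, sub_zero]
  have h3 : 0 ≤ (u - w) * (u + w - 2 * w * z.re) := by
    refine mul_nonneg (by linarith) ?_
    nlinarith
  linear_combination h3 + (w ^ 2 - u ^ 2) * h1

lemma abs_half_le_norm_exp_sub_one {φ : ℝ} (h : |φ| ≤ 1) :
    |φ| / 2 ≤ ‖Complex.exp (φ * Complex.I) - 1‖ := by
  rw [mul_comm, Complex.norm_exp_I_mul_ofReal_sub_one, norm_mul, Real.norm_eq_abs, Real.norm_eq_abs]
  have hpi := Real.pi_gt_three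
  have h4 := Real.pi_le_four
  have key : |φ| / 4 ≤ |Real.sin (φ / 2)| := by
    have h5 : |Real.sin (φ / 2)| = |Real.sin (|φ| / 2)| := by
      rcases abs_choice φ with h' | h' <;> rw [h']
      rw [neg_div, Real.sin_neg, abs_neg]
    rw [h5]
    refine le_trans ?_ (le_abs_self _)
    refine le_trans ?_ (Real.mul_le_sin (by positivity) (by linarith))
    rw [div_mul_div_comm, div_le_div_iff₀ (by norm_num) (by positivity)]
    nlinarith [abs_nonneg φ]
  rw [abs_two]; linarith

lemma half_le_cos_pow {J : ℕ} {θ : ℝ} (hθ : θ ^ 2 * J = 1) : 1 / 2 ≤ Real.cos θ ^ J := by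
  have hJ : (1 : ℝ) ≤ J := by
    rcases Nat.eq_zero_or_pos J with rfl | h
    · simp at hθ
    · exact_mod_cast h
  have hθ1 : θ ^ 2 ≤ 1 := by nlinarith [sq_nonneg θ]
  have h1 := one_add_mul_le_pow (show (-2 : ℝ) ≤ -(θ ^ 2 / 2) by linarith) J
  calc (1 : ℝ) / 2 = 1 + J * -(θ ^ 2 / 2) := by linarith
    _ ≤ (1 + -(θ ^ 2 / 2)) ^ J := h1
    _ ≤ Real.cos θ ^ J := by
      have := Real.one_sub_sq_div_two_le_cos (x := θ)
      exact pow_le_pow_left₀ (by linarith) (by linarith) _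

/-- After removing the unimodular factor of the signs beyond `t`, one factor 1/2 comes from the
damping cos^t and the other from |e^(iφ) - 1| ≥ |φ|/2. -/
lemma le_norm_expMart_sub {J : ℕ} {θ : ℝ} (hθ : θ ^ 2 * J = 1) (hc : 0 ≤ Real.cos θ)
    (x : Fin J → ℤˣ) {s t : ℕ} (hst : s ≤ t) (ht : t ≤ J) (hd : |θ| * (t - s : ℝ) ≤ 1) :
    |θ| * |∑ i ∈ Ico s t, sgn x i| / 4 ≤ ‖expMart θ t x - expMart θ s x‖ := by
  set S := ∑ i ∈ Ico s t, sgn x i with hS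
  have hle : Real.cos θ ^ t ≤ Real.cos θ ^ s := pow_le_pow_of_le_one hc (Real.cos_le_one θ) hst
  have h2 : 1 / 2 ≤ Real.cos θ ^ t :=
    (half_le_cos_pow hθ).trans (pow_le_pow_of_le_one hc (Real.cos_le_one θ) ht)
  have hSabs : |S| ≤ t - s := by
    refine (abs_sum_le_sum_abs _ _).trans (le_of_eq ?_)
    simp [abs_sgn, Nat.cast_sub hst]
  have hφ : |θ * S| ≤ 1 := by
    rw [abs_mul]
    exact (mul_le_mul_of_nonneg_left hSabs (abs_nonneg _)).trans hd
  have hdecomp : expMart θ s x - expMart θ t x =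
      Complex.exp ((θ * ∑ j ∈ Ico t J, sgn x j : ℝ) * Complex.I) *
        (((Real.cos θ ^ s : ℝ) : ℂ) * Complex.exp ((θ * S : ℝ) * Complex.I) -
          (Real.cos θ ^ t : ℝ)) := by
    rw [expMart, expMart, ← sum_Ico_consecutive _ hst ht, ← hS, mul_add, Complex.ofReal_add, add_mul,
      Complex.exp_add]
    push_cast; ring
  rw [norm_sub_rev, hdecomp, norm_mul, Complex.norm_exp_ofReal_mul_I, one_mul]
  refine le_trans ?_ (mul_norm_sub_one_le (by linarith) hle (Complex.norm_exp_ofReal_mul_I _))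
  have h3 := abs_half_le_norm_exp_sub_one hφ
  rw [abs_mul] at h3
  have : 0 ≤ |θ| * |S| := by positivity
  nlinarith

/-! ### The dynamical system -/

/-- Phase space: a position on a long cycle together with `J` sequences of random signs. -/
abbrev Phase (L J : ℕ) : Type := ZMod L × (Fin J → ZMod L → ℤˣ)

/-- The shift of the position. -/
def shift (L J : ℕ) : Equiv.Perm (Phase L J) :=
  Equiv.prodCongr (Equiv.addRight 1) (Equiv.refl _)

lemma shift_apply {L J : ℕ} (x : Phase L J) : shift L J x = (x.1 + 1, x.2) := rfl

lemma shift_zpow {L J : ℕ} (k : ℤ) (x : Phase L J) :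
    (shift L J ^ k) x = (x.1 + (k : ZMod L), x.2) := by
  induction k using Int.induction_on generalizing x with
  | zero => simp
  | succ k ih =>
    rw [zpow_add_one, Equiv.Perm.mul_apply, ih, shift_apply]
    push_cast
    simp only [add_assoc, add_comm (1 : ZMod L)]
  | pred k ih =>
    have hinv : (shift L J)⁻¹ x = (x.1 - 1, x.2) := by
      rw [Equiv.Perm.inv_eq_iff_eq, shift_apply]; simp
    rw [zpow_sub_one, Equiv.Perm.mul_apply, hinv, ih]
    push_cast
    refine Prod.ext ?_ rfl
    simp only
    ring

/-- The index of the block of length `M` that contains `m`. -/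
def block {L : ℕ} (M : ℕ) (m : ZMod L) : ZMod L := ((m.val / M : ℕ) : ZMod L)

/-- The signs seen from a phase point: the `j`-th one is constant on blocks of length `M j`. -/
def phaseSign {L J : ℕ} (M : ℕ → ℕ) (x : Phase L J) : Fin J → ℤˣ :=
  fun j => x.2 j (block (M j) x.1)

/-- Multiplying the j-th sign sequence by a constant sign preserves the law on phase space;
averaging over these constants makes the observed signs uniform at every position. -/
lemma expect_phaseSign {L J : ℕ} [NeZero L] (M : ℕ → ℕ) (φ : (Fin J → ℤˣ) → ℝ) :
    𝔼 x : Phase L J, φ (phaseSign M x) = 𝔼 ε, φ ε := by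
  have h1 : ∀ ε : Fin J → ℤˣ, 𝔼 x : Phase L J, φ (phaseSign M x) =
      𝔼 x : Phase L J, φ (ε * phaseSign M x) := fun ε => by
    let Φ : Phase L J ≃ Phase L J :=
      Equiv.prodCongr (Equiv.refl _) (Equiv.mulLeft (fun j _ => ε j))
    exact (Fintype.expect_equiv Φ _ _ (fun x => rfl)).symm
  have h2 : ∀ x : Phase L J, 𝔼 ε : Fin J → ℤˣ, φ (ε * phaseSign M x) = 𝔼 ε, φ ε := fun x =>
    Fintype.expect_equiv (Equiv.mulRight (phaseSign M x)) _ _ (fun ε => rfl)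
  calc 𝔼 x : Phase L J, φ (phaseSign M x)
      = 𝔼 ε : Fin J → ℤˣ, 𝔼 x : Phase L J, φ (ε * phaseSign M x) := by
        rw [← expect_congr rfl (fun ε _ => h1 ε), Fintype.expect_const]
    _ = 𝔼 ε, φ ε := by
        rw [expect_comm, expect_congr rfl (fun x _ => h2 x), Fintype.expect_const]

lemma expect_phase_fst {L J : ℕ} [NeZero L] (φ : ZMod L → ℝ) :
    𝔼 x : Phase L J, φ x.1 = 𝔼 m, φ m := by
  rw [← univ_product_univ, expect_product]
  simp only [Fintype.expect_const]

/-! ### Blocks rarely change under small translations -/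

/-- A unit step changes the block only on arriving at a multiple of M, the return to 0 included.
There are at most L/M + 1 ≤ 2L/M such positions, whether or not M divides L. -/
lemma expect_block_add_one_ne {L M : ℕ} [NeZero L] (hM : 0 < M) (hML : M ≤ L) :
    𝔼 m : ZMod L, (if block M (m + 1) ≠ block M m then (1 : ℝ) else 0) ≤ 2 / M := by
  have hL : 0 < L := NeZero.pos L
  have hcard : ((univ : Finset (ZMod L)).filter
      (fun m => block M (m + 1) ≠ block M m)).card ≤ L / M + 1 := by
    refine (card_le_card_of_injOn (fun m => (m + 1).val / M) (t := range (L / M + 1)) ?_ ?_).trans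
      (by simp)
    · intro m _
      simp only [coe_range, Set.mem_Iio]
      exact Nat.lt_succ_of_le (Nat.div_le_div_right (ZMod.val_lt _).le)
    · have hdvd : ∀ m : ZMod L, block M (m + 1) ≠ block M m → M ∣ (m + 1).val := fun m hm => by
        by_contra hnd
        apply hm
        rcases Nat.lt_or_ge (m.val + 1) L with h | h
        · have hv : (m + 1).val = m.val + 1 := by
            rw [← ZMod.val_natCast_of_lt h]
            simp
          rw [hv] at hnd
          rw [block, block, hv, Nat.succ_div_of_not_dvd hnd]
        · have hv : (m + 1).val = 0 := by
            rw [ZMod.val_eq_zero]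
            have h3 : m.val + 1 = L := le_antisymm (ZMod.val_lt m) h
            have h4 : ((m.val + 1 : ℕ) : ZMod L) = 0 := by rw [h3]; simp
            simpa using h4
          exact absurd (by rw [hv]; exact dvd_zero _) hnd
      intro m hm m' hm' heq
      simp only [coe_filter, mem_univ, true_and, Set.mem_ofPred_eq] at hm hm'
      have e1 := Nat.div_mul_cancel (hdvd m hm)
      have e2 := Nat.div_mul_cancel (hdvd m' hm')
      simp only at heq
      rw [heq, e2] at e1
      exact add_right_cancel (ZMod.val_injective L e1).symm
  rw [Fintype.expect_eq_sum_div_card, ZMod.card, sum_boole, div_le_div_iff₀ (by positivity)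
    (by positivity)]
  have h1 : (L / M + 1) * M ≤ 2 * L := by
    have := Nat.div_mul_le_self L M
    nlinarith
  calc _ ≤ ((L / M + 1 : ℕ) : ℝ) * M := by gcongr
    _ ≤ 2 * L := by exact_mod_cast h1

lemma expect_block_add_ne {L M : ℕ} [NeZero L] (hM : 0 < M) (hML : M ≤ L) (k : ℤ) :
    𝔼 m : ZMod L, (if block M (m + (k : ZMod L)) ≠ block M m then (1 : ℝ) else 0) ≤
      2 * |(k : ℝ)| / M := by
  have hnat : ∀ n : ℕ, 𝔼 m : ZMod L, (if block M (m + (n : ZMod L)) ≠ block M m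
      then (1 : ℝ) else 0) ≤ 2 * n / M := fun n => by
    induction n with
    | zero => simp
    | succ n ih =>
      have hpt : ∀ m : ZMod L, (if block M (m + ((n + 1 : ℕ) : ZMod L)) ≠ block M m
          then (1 : ℝ) else 0) ≤
          (if block M (m + (n : ZMod L) + 1) ≠ block M (m + (n : ZMod L)) then (1 : ℝ) else 0) +
          (if block M (m + (n : ZMod L)) ≠ block M m then (1 : ℝ) else 0) := fun m => by
        rw [Nat.cast_succ, ← add_assoc]
        by_cases h1 : block M (m + (n : ZMod L) + 1) = block M (m + (n : ZMod L))
        · by_cases h2 : block M (m + (n : ZMod L)) = block M m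
          · simp [h1, h2]
          · simp [h1, h2]
        · rw [if_pos h1]
          split_ifs <;> norm_num
      refine (expect_le_expect (fun m _ => hpt m)).trans ?_
      rw [expect_add_distrib]
      have h3 : 𝔼 m : ZMod L, (if block M (m + (n : ZMod L) + 1) ≠ block M (m + (n : ZMod L)) then (1 : ℝ) else 0) =
          𝔼 m : ZMod L, (if block M (m + 1) ≠ block M m then (1 : ℝ) else 0) :=
        Fintype.expect_equiv (Equiv.addRight (n : ZMod L)) _ _ (fun m => rfl)
      rw [h3]
      have h4 := expect_block_add_one_ne hM hML
      have e : 2 * ((n + 1 : ℕ) : ℝ) / M = 2 / M + 2 * n / M := by push_cast; ring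
      rw [e]; linarith
  obtain ⟨n, rfl | rfl⟩ := k.eq_nat_or_neg
  · simpa using hnat n
  · have h5 : 𝔼 m : ZMod L, (if block M (m + ((-(n : ℤ) : ℤ) : ZMod L)) ≠ block M m
        then (1 : ℝ) else 0) =
        𝔼 m : ZMod L, (if block M (m + (n : ZMod L)) ≠ block M m then (1 : ℝ) else 0) := by
      refine Fintype.expect_equiv (Equiv.addRight ((-(n : ℤ) : ℤ) : ZMod L)) _ _ (fun m => ?_)
      simp [ne_comm]
    rw [h5]
    simpa using hnat n

/-- In a common block the representatives differ by less than M. The upper bound on |a - b| excludes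
going round the cycle, so a - b would be that same small difference. -/
lemma block_ne_of_le {L M : ℕ} [NeZero L] (hM : 0 < M) (m : ZMod L) (a b : ℤ)
    (hab : (M : ℤ) ≤ |a - b|) (hL : |a - b| + M ≤ L) :
    block M (m + (a : ZMod L)) ≠ block M (m + (b : ZMod L)) := by
  intro h
  set v := (m + (a : ZMod L)).val with hv
  set w := (m + (b : ZMod L)).val with hw
  have hvL : v < L := ZMod.val_lt _
  have hwL : w < L := ZMod.val_lt _
  have hdiv : v / M = w / M := by
    have := (ZMod.natCast_eq_natCast_iff' _ _ _).1 h
    rwa [Nat.mod_eq_of_lt ((Nat.div_le_self _ _).trans_lt hvL),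
      Nat.mod_eq_of_lt ((Nat.div_le_self _ _).trans_lt hwL)] at this
  have hvw : |(v : ℤ) - w| < M := by
    have h1 := Nat.div_add_mod v M
    have h2 := Nat.div_add_mod w M
    have h3 := Nat.mod_lt v hM
    have h4 := Nat.mod_lt w hM
    rw [hdiv] at h1
    rw [abs_lt]
    omega
  have hdvd : (L : ℤ) ∣ (a - b) - ((v : ℤ) - w) := by
    rw [← ZMod.intCast_zmod_eq_zero_iff_dvd]
    push_cast
    rw [hv, hw, ZMod.natCast_zmod_val, ZMod.natCast_zmod_val]
    ring
  have hzero : (a - b) - ((v : ℤ) - w) = 0 := by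
    refine Int.eq_zero_of_abs_lt_dvd hdvd ?_
    have := abs_sub (a - b) ((v : ℤ) - w)
    omega
  have : a - b = (v : ℤ) - w := by omega
  rw [this] at hab
  omega

/-! ### Averages -/

lemma polyAverage_sub {X : Type*} (T : Equiv.Perm X) (P : Polynomial ℤ) (f g : X → ℂ) (N : ℕ+)
    (x : X) : polyAverage T P (fun y => f y - g y) N x =
      polyAverage T P f N x - polyAverage T P g N x := by
  simp only [polyAverage, sum_sub_distrib, mul_sub]

lemma polyAverage_sum {X κ : Type*} (T : Equiv.Perm X) (P : Polynomial ℤ) (s : Finset κ)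
    (f : κ → X → ℂ) (N : ℕ+) (x : X) : polyAverage T P (fun y => ∑ i ∈ s, f i y) N x =
      ∑ i ∈ s, polyAverage T P (f i) N x := by
  simp only [polyAverage]
  rw [sum_comm, mul_sum]

/-- A function of the slow signs is almost invariant under short averages. -/
lemma expect_polyAverage_sub_self {L J : ℕ} [NeZero L] (M : ℕ → ℕ) (i : ℕ) (g : (Fin J → ℤˣ) → ℂ)
    (hg1 : ∀ ε, ‖g ε‖ ≤ 1) (hg : ∀ ε ε' : Fin J → ℤˣ, (∀ j : Fin J, i ≤ j → ε j = ε' j) → g ε = g ε')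
    (P : Polynomial ℤ) (N : ℕ+) (K : ℝ) (hK : 0 < K) (hM : ∀ j, i ≤ j → j < J → 0 < M j ∧ M j ≤ L)
    (hP : ∀ j, i ≤ j → j < J → ∀ n ∈ Icc 1 (N : ℕ), K * |((P.eval (n : ℤ) : ℤ) : ℝ)| ≤ M j) :
    𝔼 x : Phase L J, ‖polyAverage (shift L J) P (fun y => g (phaseSign M y)) N x -
      g (phaseSign M x)‖ ^ 2 ≤ 8 * J / K := by
  classical
  have hN : (0 : ℝ) < (N : ℕ) := by exact_mod_cast N.pos
  have hshift : ∀ k : ℤ, (∀ j, i ≤ j → j < J → K * |(k : ℝ)| ≤ M j) →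
      𝔼 x : Phase L J, ‖g (phaseSign M ((shift L J ^ k) x)) - g (phaseSign M x)‖ ^ 2 ≤
        8 * J / K := fun k hk => by
    -- Union bound over the slow signs: if no block changes the difference is 0, otherwise its
    -- square is at most 2² = 4.
    have hpt : ∀ x : Phase L J, ‖g (phaseSign M ((shift L J ^ k) x)) - g (phaseSign M x)‖ ^ 2 ≤
        ∑ j : Fin J, 4 * (if i ≤ j ∧ block (M j) (x.1 + (k : ZMod L)) ≠ block (M j) x.1
          then (1 : ℝ) else 0) := fun x => by
      by_cases hall : ∀ j : Fin J, i ≤ j →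
          block (M j) (x.1 + (k : ZMod L)) = block (M j) x.1
      · rw [hg _ (phaseSign M x), sub_self]
        · simp only [norm_zero, ne_eq, OfNat.ofNat_ne_zero, not_false_eq_true, zero_pow]
          exact sum_nonneg (fun j _ => by positivity)
        · intro j hj
          rw [shift_zpow]
          simp only [phaseSign, hall j hj]
      · push Not at hall
        obtain ⟨j, hj, hne⟩ := hall
        have h1 : ‖g (phaseSign M ((shift L J ^ k) x)) - g (phaseSign M x)‖ ≤ 2 :=
          (norm_sub_le _ _).trans ((add_le_add (hg1 _) (hg1 _)).trans (by norm_num))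
        calc _ ≤ (2 : ℝ) ^ 2 := by gcongr
          _ = 4 * (if i ≤ j ∧ block (M j) (x.1 + (k : ZMod L)) ≠ block (M j) x.1
              then (1 : ℝ) else 0) := by rw [if_pos ⟨hj, hne⟩]; norm_num
          _ ≤ _ := single_le_sum (f := fun j : Fin J => 4 * (if i ≤ j ∧
              block (M j) (x.1 + (k : ZMod L)) ≠ block (M j) x.1 then (1 : ℝ) else 0))
              (fun _ _ => by positivity) (mem_univ j)
    refine (expect_le_expect (fun x _ => hpt x)).trans ?_
    rw [expect_sum_comm]
    have hj : ∀ j : Fin J, 𝔼 x : Phase L J, 4 * (if i ≤ j ∧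
        block (M j) (x.1 + (k : ZMod L)) ≠ block (M j) x.1 then (1 : ℝ) else 0) ≤ 8 / K := by
      intro j
      by_cases hij : i ≤ j
      · obtain ⟨hM0, hML⟩ := hM j hij j.2
        have hM0' : (0 : ℝ) < M j := by exact_mod_cast hM0
        simp only [hij, true_and]
        rw [← mul_expect, expect_phase_fst (fun m =>
          if block (M j) (m + (k : ZMod L)) ≠ block (M j) m then (1 : ℝ) else 0)]
        have h2 := expect_block_add_ne hM0 hML k
        have h3 : 2 * |(k : ℝ)| / M j ≤ 2 / K := by
          rw [div_le_div_iff₀ hM0' hK]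
          linarith [hk j hij j.2]
        calc _ ≤ 4 * (2 / K) := by linarith
          _ = 8 / K := by ring
      · simp only [hij, false_and, if_false, mul_zero, expect_const_zero]
        positivity
    refine (sum_le_sum (fun j _ => hj j)).trans (le_of_eq ?_)
    simp; ring
  have hpt : ∀ x : Phase L J, ‖polyAverage (shift L J) P (fun y => g (phaseSign M y)) N x -
      g (phaseSign M x)‖ ^ 2 ≤ (1 / (N : ℕ) : ℝ) * ∑ n ∈ Icc 1 (N : ℕ),
        ‖g (phaseSign M ((shift L J ^ (P.eval (n : ℤ))) x)) - g (phaseSign M x)‖ ^ 2 := fun x => by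
    have e : polyAverage (shift L J) P (fun y => g (phaseSign M y)) N x - g (phaseSign M x) =
        (1 / ((N : ℕ) : ℂ)) * ∑ n ∈ Icc 1 (N : ℕ),
          (g (phaseSign M ((shift L J ^ (P.eval (n : ℤ))) x)) - g (phaseSign M x)) := by
      have : ((N : ℕ) : ℂ) ≠ 0 := by exact_mod_cast N.ne_zero
      rw [polyAverage, sum_sub_distrib, sum_const, Nat.card_Icc, add_tsub_cancel_right,
        nsmul_eq_mul]
      field_simp
    rw [e, norm_mul, mul_pow]
    have h1 : ‖(1 / ((N : ℕ) : ℂ))‖ = 1 / (N : ℕ) := by simp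
    rw [h1]
    have h2 := norm_sum_le (Icc 1 (N : ℕ)) (fun n =>
      g (phaseSign M ((shift L J ^ (P.eval (n : ℤ))) x)) - g (phaseSign M x))
    have h3 := sq_sum_le_card_mul_sum_sq (s := Icc 1 (N : ℕ)) (f := fun n =>
      ‖g (phaseSign M ((shift L J ^ (P.eval (n : ℤ))) x)) - g (phaseSign M x)‖)
    rw [Nat.card_Icc, add_tsub_cancel_right] at h3
    calc _ ≤ (1 / (N : ℕ) : ℝ) ^ 2 * ((N : ℕ) * ∑ n ∈ Icc 1 (N : ℕ),
        ‖g (phaseSign M ((shift L J ^ (P.eval (n : ℤ))) x)) - g (phaseSign M x)‖ ^ 2) := by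
          gcongr
          exact (pow_le_pow_left₀ (norm_nonneg _) h2 2).trans h3
      _ = _ := by field_simp
  refine (expect_le_expect (fun x _ => hpt x)).trans ?_
  rw [← mul_expect, expect_sum_comm]
  have h4 := sum_le_sum (s := Icc 1 (N : ℕ)) (fun n hn => hshift (P.eval (n : ℤ))
    (fun j hij hj => hP j hij hj n hn))
  rw [sum_const, Nat.card_Icc, add_tsub_cancel_right, nsmul_eq_mul] at h4
  calc _ ≤ (1 / (N : ℕ) : ℝ) * ((N : ℕ) * (8 * J / K)) := by gcongr
    _ = _ := by field_simp

/-- Values of a polynomial are rarely close to each other. -/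
lemma card_eval_close_le (P : Polynomial ℤ) (hP : 0 < P.natDegree) (N M : ℕ) (c : ℤ) :
    ((Icc 1 N).filter (fun n : ℕ => |c - P.eval (n : ℤ)| < M)).card ≤ 2 * M * P.natDegree := by
  classical
  have hfib : ∀ v : ℤ, ((Icc 1 N).filter (fun n : ℕ => P.eval (n : ℤ) = v)).card ≤
      P.natDegree := fun v => by
    have hne : P - Polynomial.C v ≠ 0 := fun h => by
      have := congrArg Polynomial.natDegree h
      rw [Polynomial.natDegree_sub_C, Polynomial.natDegree_zero] at this
      omega
    have h1 : ((Icc 1 N).filter (fun n : ℕ => P.eval (n : ℤ) = v)).card ≤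
        (P - Polynomial.C v).roots.toFinset.card := by
      refine card_le_card_of_injOn (fun n : ℕ => (n : ℤ)) (fun n hn => ?_)
        (fun a _ b _ h => Int.ofNat_inj.1 h)
      simp only [coe_filter, Set.mem_ofPred_eq] at hn
      simpa [hn.2] using hne
    refine h1.trans ((Multiset.toFinset_card_le _).trans ((Polynomial.card_roots' _).trans ?_))
    rw [Polynomial.natDegree_sub_C]
  have hsub : (Icc 1 N).filter (fun n : ℕ => |c - P.eval (n : ℤ)| < M) ⊆
      (Ico (c - M) (c + M)).biUnion
        (fun v => (Icc 1 N).filter (fun n : ℕ => P.eval (n : ℤ) = v)) := fun n hn => by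
    simp only [mem_filter, mem_biUnion, abs_lt, mem_Ico] at hn ⊢
    exact ⟨P.eval (n : ℤ), ⟨by omega, by omega⟩, hn.1, rfl⟩
  refine (card_le_card hsub).trans (card_biUnion_le.trans ((sum_le_sum fun v _ => hfib v).trans ?_))
  rw [sum_const, Int.card_Ico, smul_eq_mul]
  gcongr
  omega

/-- Long averages of a function that is odd in a fast sign are small. -/
lemma expect_polyAverage_odd {L J : ℕ} [NeZero L] (M : ℕ → ℕ) (i : Fin J) (hM : 0 < M i)
    (g : (Fin J → ℤˣ) → ℂ) (hg2 : ∀ ε, ‖g ε‖ ≤ 2)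
    (hg : ∀ ε ε' : Fin J → ℤˣ, (∀ j, j ≠ i → ε j = ε' j) → ε i = -ε' i → g ε = -g ε')
    (P : Polynomial ℤ) (hP : 0 < P.natDegree) (N : ℕ+)
    (hL : ∀ n ∈ Icc 1 (N : ℕ), ∀ n' ∈ Icc 1 (N : ℕ),
      |P.eval (n : ℤ) - P.eval (n' : ℤ)| + M i ≤ L) :
    𝔼 x : Phase L J, ‖polyAverage (shift L J) P (fun y => g (phaseSign M y)) N x‖ ^ 2 ≤
      8 * P.natDegree * M i / (N : ℕ) := by
  classical
  have hN : (0 : ℝ) < (N : ℕ) := by exact_mod_cast N.pos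
  set h : ℕ → Phase L J → ℂ := fun n x => g (phaseSign M ((shift L J ^ (P.eval (n : ℤ))) x)) with hh
  have hexp : ∀ x : Phase L J,
      ‖polyAverage (shift L J) P (fun y => g (phaseSign M y)) N x‖ ^ 2 =
      (1 / (N : ℕ) : ℝ) ^ 2 * ∑ n ∈ Icc 1 (N : ℕ), ∑ n' ∈ Icc 1 (N : ℕ),
        inner ℝ (h n x) (h n' x) := fun x => by
    rw [polyAverage, norm_mul, mul_pow, ← real_inner_self_eq_norm_sq (∑ n ∈ Icc 1 (N : ℕ), _),
      sum_inner]
    congr 2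
    · simp
    · funext n
      rw [inner_sum]
  have hcorr : ∀ n n' : ℕ, (M i : ℤ) ≤ |P.eval (n : ℤ) - P.eval (n' : ℤ)| →
      |P.eval (n : ℤ) - P.eval (n' : ℤ)| + M i ≤ L →
      𝔼 x : Phase L J, inner ℝ (h n x) (h n' x) = 0 := fun n n' h1 h2 => by
    -- Flip the single sign read at time P(n). The flip depends only on the position, which it
    -- leaves fixed, so it is a bijection. The sign read at time P(n') lies in another block and is
    -- untouched.
    let τ : ZMod L → Fin J → ZMod L → ℤˣ := fun m j y =>
      if j = i ∧ y = block (M i) (m + ((P.eval (n : ℤ) : ℤ) : ZMod L)) then -1 else 1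
    let Φ : Phase L J ≃ Phase L J :=
      { toFun := fun x => (x.1, τ x.1 * x.2)
        invFun := fun x => (x.1, (τ x.1)⁻¹ * x.2)
        left_inv := fun x => by simp
        right_inv := fun x => by simp }
    have hodd : ∀ x, inner ℝ (h n (Φ x)) (h n' (Φ x)) = -inner ℝ (h n x) (h n' x) := fun x => by
      have e1 : h n (Φ x) = -h n x := by
        refine hg _ _ (fun j hj => ?_) ?_
        · simp [shift_zpow, phaseSign, Φ, τ, hj]
        · simp [shift_zpow, phaseSign, Φ, τ]
      have e2 : h n' (Φ x) = h n' x := by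
        simp only [hh]
        congr 1
        funext j
        have := block_ne_of_le hM x.1 _ _ h1 h2
        by_cases hj : j = i
        · subst hj
          simp [shift_zpow, phaseSign, Φ, τ, this.symm]
        · simp [shift_zpow, phaseSign, Φ, τ, hj]
      rw [e1, e2, inner_neg_left]
    have h3 : 𝔼 x : Phase L J, inner ℝ (h n (Φ x)) (h n' (Φ x)) =
        𝔼 x : Phase L J, inner ℝ (h n x) (h n' x) := Fintype.expect_equiv Φ _ _ (fun _ => rfl)
    rw [expect_congr rfl (fun x _ => hodd x), expect_neg_distrib] at h3
    linarith
  have hbd : ∀ n n' : ℕ, 𝔼 x : Phase L J, inner ℝ (h n x) (h n' x) ≤ 4 := fun n n' => by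
    refine expect_le univ_nonempty (fun x _ => (real_inner_le_norm _ _).trans ?_)
    have := mul_le_mul (hg2 (phaseSign M ((shift L J ^ (P.eval (n : ℤ))) x)))
      (hg2 (phaseSign M ((shift L J ^ (P.eval (n' : ℤ))) x))) (norm_nonneg _) (by norm_num)
    linarith
  have hrow : ∀ n ∈ Icc 1 (N : ℕ), ∑ n' ∈ Icc 1 (N : ℕ), 𝔼 x : Phase L J,
      inner ℝ (h n x) (h n' x) ≤ 8 * P.natDegree * M i := fun n hn => by
    have h4 : ∀ n' ∈ Icc 1 (N : ℕ), 𝔼 x : Phase L J, inner ℝ (h n x) (h n' x) ≤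
        4 * (if |P.eval (n : ℤ) - P.eval (n' : ℤ)| < M i then (1 : ℝ) else 0) := fun n' hn' => by
      split_ifs with hc
      · simpa using hbd n n'
      · rw [hcorr n n' (not_lt.1 hc) (hL n hn n' hn')]; simp
    refine (sum_le_sum h4).trans ?_
    rw [← mul_sum, sum_boole]
    have h5 := card_eval_close_le P hP N (M i) (P.eval (n : ℤ))
    have h6 : (((Icc 1 (N : ℕ)).filter (fun n' : ℕ =>
        |P.eval (n : ℤ) - P.eval (n' : ℤ)| < M i)).card : ℝ) ≤ 2 * M i * P.natDegree := by
      exact_mod_cast h5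
    linarith
  simp only [hexp]
  rw [← mul_expect, expect_sum_comm]
  simp only [expect_sum_comm]
  have h7 := sum_le_sum hrow
  rw [sum_const, Nat.card_Icc, add_tsub_cancel_right, nsmul_eq_mul] at h7
  calc _ ≤ (1 / (N : ℕ) : ℝ) ^ 2 * ((N : ℕ) * (8 * P.natDegree * M i)) := by gcongr
    _ = _ := by field_simp

/-- The polynomial averages of the terminal value follow the exponential martingale. -/
lemma expect_polyAverage_expMart {L J : ℕ} [NeZero L] (θ : ℝ) (M : ℕ → ℕ) (K : ℝ) (hK : 0 < K)
    (P : Polynomial ℤ) (hP : 0 < P.natDegree) (N : ℕ+) (i : ℕ) (hi : i ≤ J)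
    (hM : ∀ j, j < J → 0 < M j ∧ M j ≤ L)
    (hslow : ∀ j, i ≤ j → j < J → ∀ n ∈ Icc 1 (N : ℕ), K * |((P.eval (n : ℤ) : ℤ) : ℝ)| ≤ M j)
    (hfast : ∀ j, j < i → K * M j ≤ (N : ℕ))
    (hL : ∀ n ∈ Icc 1 (N : ℕ), ∀ n' ∈ Icc 1 (N : ℕ), ∀ j < i,
      |P.eval (n : ℤ) - P.eval (n' : ℤ)| + M j ≤ L) :
    𝔼 x : Phase L J, ‖polyAverage (shift L J) P (fun y => expMart θ 0 (phaseSign M y)) N x -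
      expMart θ i (phaseSign M x)‖ ^ 2 ≤ 8 * (J + 1) ^ 2 * (P.natDegree + 1) / K := by
  have hN : (0 : ℝ) < (N : ℕ) := by exact_mod_cast N.pos
  set A : ℕ → Phase L J → ℂ := fun j x => polyAverage (shift L J) P
    (fun y => expMart θ j (phaseSign M y) - expMart θ (j + 1) (phaseSign M y)) N x with hA
  set R : Phase L J → ℂ := fun x => polyAverage (shift L J) P
    (fun y => expMart θ i (phaseSign M y)) N x - expMart θ i (phaseSign M x) with hR
  -- Telescoping splits the error into averages of the fast martingale differences j < i and one
  -- slow remainder.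
  have hdec : ∀ x, polyAverage (shift L J) P (fun y => expMart θ 0 (phaseSign M y)) N x -
      expMart θ i (phaseSign M x) = ∑ j ∈ range i, A j x + R x := fun x => by
    simp only [hA, hR, ← polyAverage_sum]
    simp only [sum_range_sub' (fun j => expMart θ j (phaseSign M _)), polyAverage_sub]
    ring
  have hA2 : ∀ j ∈ range i, 𝔼 x, ‖A j x‖ ^ 2 ≤ 8 * P.natDegree / K := fun j hj => by
    rw [mem_range] at hj
    have hjJ : j < J := by omega
    have h1 := expect_polyAverage_odd (L := L) M ⟨j, hjJ⟩ (hM j hjJ).1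
      (fun ε => expMart θ j ε - expMart θ (j + 1) ε)
      (fun ε => (norm_sub_le _ _).trans (by
        linarith [norm_expMart_le θ j ε, norm_expMart_le θ (j + 1) ε]))
      (fun ε ε' h1 h2 => expMart_sub_succ_flip θ hjJ ε ε'
        (fun t ht => h1 t (fun h => ht (by rw [h]))) h2) P hP N
      (fun n hn n' hn' => hL n hn n' hn' j hj)
    refine h1.trans ?_
    rw [div_le_div_iff₀ hN hK]
    have := mul_le_mul_of_nonneg_left (hfast j hj) (show (0 : ℝ) ≤ 8 * P.natDegree by positivity)
    linarith
  have hR2 : 𝔼 x, ‖R x‖ ^ 2 ≤ 8 * J / K :=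
    expect_polyAverage_sub_self M i (expMart θ i) (norm_expMart_le θ i) (expMart_congr θ i) P N K hK
      (fun j _ hj => hM j hj) hslow
  have hpt : ∀ x, ‖polyAverage (shift L J) P (fun y => expMart θ 0 (phaseSign M y)) N x -
      expMart θ i (phaseSign M x)‖ ^ 2 ≤ (i + 1) * (∑ j ∈ range i, ‖A j x‖ ^ 2 + ‖R x‖ ^ 2) :=
    fun x => by
    rw [hdec]
    have h1 : ‖∑ j ∈ range i, A j x + R x‖ ≤
        ∑ j ∈ range (i + 1), (if j < i then ‖A j x‖ else ‖R x‖) := by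
      rw [sum_range_succ, if_neg (lt_irrefl i),
        sum_congr rfl (fun j hj => if_pos (mem_range.1 hj))]
      exact (norm_add_le _ _).trans (by gcongr; exact norm_sum_le _ _)
    refine (pow_le_pow_left₀ (norm_nonneg _) h1 2).trans (sq_sum_le_card_mul_sum_sq.trans ?_)
    rw [sum_range_succ, if_neg (lt_irrefl i),
      sum_congr rfl (fun j hj => by rw [if_pos (mem_range.1 hj)])]
    simp
  refine (expect_le_expect (fun x _ => hpt x)).trans ?_
  rw [← mul_expect, expect_add_distrib, expect_sum_comm]
  have h2 := sum_le_sum hA2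
  rw [sum_const, card_range, nsmul_eq_mul] at h2
  have hiJ : (i : ℝ) ≤ J := by exact_mod_cast hi
  calc _ ≤ ((J : ℝ) + 1) * (J * (8 * P.natDegree / K) + 8 * J / K) := by
        have : (i : ℝ) * (8 * P.natDegree / K) ≤ J * (8 * P.natDegree / K) := by gcongr
        have h3 : (0 : ℝ) ≤ J * (8 * P.natDegree / K) + 8 * J / K := by positivity
        refine (mul_le_mul_of_nonneg_left (add_le_add (h2.trans this) hR2) (by positivity)).trans ?_
        gcongr
    _ = 8 * ((J + 1) * J) * (P.natDegree + 1) / K := by ring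
    _ ≤ _ := by
      gcongr
      nlinarith

/-! ### Passage to measure theory -/

/-- With the uniform measure on all subsets, a bound `r` on half of the points gives L^p norm at
least r·2^(-1/p). For p = ∞ the exponent `1 / p.toReal` is 0 and the factor is 1. -/
lemma exists_finite_system {X : Type} [Fintype X] [Nonempty X] (T : Equiv.Perm X) (P : Polynomial ℤ)
    (p : ℝ≥0∞) (hp : 0 < p) (I : Set ℕ+) (C : ℝ≥0) (f : X → ℂ) (hf : ∀ x, ‖f x‖ ≤ 1)
    (good : Finset X) (hgood : Fintype.card X ≤ 2 * good.card) (r : ℝ)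
    (hr : ∀ x ∈ good, ENNReal.ofReal r ≤ rVariation 2 (fun N : I => polyAverage T P f (N : ℕ+) x))
    (hC : (C : ℝ≥0∞) < ENNReal.ofReal r * (1 / 2) ^ (1 / p.toReal)) :
    ∃ (X : Type) (_ : MeasurableSpace X) (μ : Measure X) (T : X ≃ᵐ X),
      IsProbabilityMeasure μ ∧ MeasurePreserving T μ μ ∧
      ∃ f : X → ℂ, MemLp f ∞ μ ∧ eLpNorm f ∞ μ ≤ 1 ∧
        (C : ℝ≥0∞) < eLpVariation (fun N : I => polyAverage T.toEquiv P f (N : ℕ+)) p 2 μ := by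
  let _ : MeasurableSpace X := ⊤
  set μ : Measure X := ProbabilityTheory.uniformOn Set.univ with hμ
  have hμs : ∀ s : Finset X, μ (s : Set X) = s.card / Fintype.card X := fun s => by
    rw [hμ, ProbabilityTheory.uniformOn_univ, Measure.count_apply_finset]
  have hmeas : Measurable f := measurable_from_top
  let T' : X ≃ᵐ X := ⟨T, measurable_from_top, measurable_from_top⟩
  have hbound : ∀ᵐ x ∂μ, ‖f x‖ ≤ 1 := Filter.Eventually.of_forall hf
  refine ⟨X, ⊤, μ, T', inferInstance, ⟨T'.measurable, ?_⟩, f,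
    memLp_top_of_bound hmeas.aestronglyMeasurable 1 hbound, ?_, ?_⟩
  · refine Measure.ext (fun s _ => ?_)
    classical
    rw [Measure.map_apply T'.measurable trivial, ← Set.coe_toFinset s]
    have : T' ⁻¹' (s.toFinset : Set X) = ((s.toFinset.map T.symm.toEmbedding : Finset X) : Set X) := by
      ext x
      simp only [Set.coe_toFinset, Set.mem_preimage, coe_map, Equiv.coe_toEmbedding,
        Set.mem_image_equiv, Equiv.symm_symm]
      rfl
    rw [this, hμs, hμs, card_map]
  · rw [eLpNorm_exponent_top]
    simpa using eLpNormEssSup_le_of_ae_bound hbound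
  · have hcard : (0 : ℝ≥0∞) < Fintype.card X := by exact_mod_cast Fintype.card_pos
    have hhalf : (1 / 2 : ℝ≥0∞) ≤ μ (good : Set X) := by
      rw [hμs, ENNReal.le_div_iff_mul_le (Or.inl hcard.ne') (Or.inl (ENNReal.natCast_ne_top _)),
        one_div, ENNReal.inv_mul_le_iff (by norm_num) (by norm_num)]
      exact_mod_cast hgood
    have hr0 : 0 ≤ r := le_of_not_gt fun h => by
      simp [ENNReal.ofReal_of_nonpos h.le] at hC
    refine hC.trans_le ?_
    calc ENNReal.ofReal r * (1 / 2) ^ (1 / p.toReal)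
        ≤ ‖r‖ₑ * μ (good : Set X) ^ (1 / p.toReal) := by
          rw [Real.enorm_of_nonneg hr0]
          gcongr
      _ = eLpNorm ((good : Set X).indicator fun _ => r) p μ := by
          exact (eLpNorm_indicator_const' (s := (good : Set X)) (by trivial)
            (lt_of_lt_of_le (by norm_num) hhalf).ne' hp.ne').symm
      _ ≤ _ := by
          refine eLpNorm_mono_enorm (fun x => ?_)
          by_cases hx : x ∈ (good : Set X)
          · rw [Set.indicator_of_mem hx, Real.enorm_of_nonneg hr0, enorm_eq_self]
            exact hr x hx
          · simp [Set.indicator_of_notMem hx]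

/-- Infinite sets of positive integers contain arbitrarily sparse sequences. -/
lemma exists_sparse_sequence {I : Set ℕ+} (hI : I.Infinite) (φ : ℕ+ → ℕ) :
    ∃ N : ℕ → I, StrictMono N ∧ ∀ j, φ (N j) ≤ ((N (j + 1) : ℕ+) : ℕ) := by
  have hnext : ∀ a : I, ∃ b : I, a < b ∧ φ a ≤ ((b : ℕ+) : ℕ) := fun a => by
    obtain ⟨b, hb, hlt⟩ := hI.exists_gt ((a : ℕ+) + Nat.succPNat (φ a))
    refine ⟨⟨b, hb⟩, ?_, ?_⟩
    · have h1 : (a : ℕ+) < b := lt_trans (PNat.lt_add_right _ _) hlt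
      exact h1
    · have h1 : (((a : ℕ+) + Nat.succPNat (φ a) : ℕ+) : ℕ) < (b : ℕ) := hlt
      rw [PNat.add_coe, Nat.succPNat_coe] at h1
      change φ a ≤ (b : ℕ)
      omega
  choose g hg1 hg2 using hnext
  obtain ⟨a, ha⟩ := hI.nonempty
  refine ⟨fun n => g^[n] ⟨a, ha⟩, strictMono_nat_of_lt_succ (fun n => ?_), fun n => ?_⟩
  · rw [Function.iterate_succ_apply']; exact hg1 _
  · simp only [Function.iterate_succ_apply']; exact hg2 _

/-- If the averages are close to the exponential martingale, their `2`-variation is controlled from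
below by the block variations of the path. -/
lemma le_rVariation_of_close {ι : Type*} [LinearOrder ι] (F : ι → ℂ) (N : ℕ → ι) (hN : Monotone N)
    {B k l m : ℕ} (hBk : B ^ k = l) {θ : ℝ} (hJ : θ ^ 2 * (m * l : ℕ) = 1) (hc : 0 ≤ Real.cos θ)
    (hl : |θ| * l ≤ 1) (x : Fin (m * l) → ℤˣ)
    (hclose : ∀ i ≤ m * l, ‖F (N i) - expMart θ i x‖ ≤ |θ| / 16) :
    ENNReal.ofReal (Real.sqrt (θ ^ 2 / 64 * ∑ i ∈ range m, blockVar B (sgn x) k (i * l))) ≤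
      rVariation 2 F := by
  have hstep : ∀ i < m, ∀ s t, i * l ≤ s → s ≤ t → t ≤ i * l + l →
      θ ^ 2 / 64 * (∑ j ∈ Ico s t, sgn x j) ^ 2 ≤ ‖F (N t) - F (N s)‖ ^ 2 := by
    intro i hi s t hs hst ht
    have hwin : i * l + l ≤ m * l := by
      calc i * l + l = (i + 1) * l := by ring
        _ ≤ m * l := Nat.mul_le_mul_right _ hi
    set S := ∑ j ∈ Ico s t, sgn x j with hS
    by_cases hS0 : S = 0
    · rw [hS0]; simp only [ne_eq, OfNat.ofNat_ne_zero, not_false_eq_true, zero_pow, mul_zero]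
      positivity
    -- The walk is integer valued, so a nonzero increment absorbs the two approximation errors:
    -- |θ||S|/4 - 2|θ|/16 ≥ |θ||S|/8.
    have hS1 : 1 ≤ |S| := by
      have hcast : S = ((∑ j ∈ Ico s t, (signExt x j : ℤ) : ℤ) : ℝ) := by
        rw [hS]; push_cast; rfl
      rw [hcast] at hS0 ⊢
      rw [← Int.cast_abs]
      exact_mod_cast Int.one_le_abs (by exact_mod_cast hS0)
    have hts : (t : ℝ) - s ≤ l := by
      have : (t : ℝ) ≤ s + l := by exact_mod_cast (by omega : t ≤ s + l)
      linarith
    have h1 := le_norm_expMart_sub hJ hc x hst (by omega)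
      ((mul_le_mul_of_nonneg_left hts (abs_nonneg θ)).trans hl)
    have h2 := hclose t (by omega)
    have h3 := hclose s (by omega)
    have h4 : ‖expMart θ t x - expMart θ s x‖ ≤ ‖F (N t) - F (N s)‖ +
        (‖F (N t) - expMart θ t x‖ + ‖F (N s) - expMart θ s x‖) := by
      have e : expMart θ t x - expMart θ s x = (F (N t) - F (N s)) -
          ((F (N t) - expMart θ t x) - (F (N s) - expMart θ s x)) := by ring
      rw [e]
      exact (norm_sub_le _ _).trans (by gcongr; exact norm_sub_le _ _)
    have h5 : |θ| ≤ |θ| * |S| := le_mul_of_one_le_right (abs_nonneg _) hS1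
    have h6 : |θ| * |S| / 8 ≤ ‖F (N t) - F (N s)‖ := by linarith
    calc θ ^ 2 / 64 * S ^ 2 = (|θ| * |S| / 8) ^ 2 := by
          rw [div_pow, mul_pow, sq_abs, sq_abs]; ring
      _ ≤ _ := by gcongr
  obtain ⟨v, hv, hle⟩ := exists_isPartitionSum_windows (d := fun s t => ‖F (N t) - F (N s)‖ ^ 2)
    (fun i => θ ^ 2 / 64 * blockVar B (sgn x) k (i * l)) 0 l m (fun i hi => by
      subst hBk
      rw [zero_add]
      exact exists_isPartitionSum_blockVar (sgn x) k _ (hstep i hi))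
  rw [← mul_sum] at hle
  exact (ENNReal.ofReal_le_ofReal (Real.sqrt_le_sqrt hle)).trans (ofReal_sqrt_le_rVariation F N hN hv)

/-- A bound for the values of a polynomial at `1, …, N`. -/
def evalBound (P : Polynomial ℤ) (N : ℕ) : ℕ := 1 + ∑ n ∈ Icc 1 N, (P.eval (n : ℤ)).natAbs

lemma evalBound_mono (P : Polynomial ℤ) : Monotone (evalBound P) := fun a b hab => by
  unfold evalBound
  gcongr

lemma abs_eval_le_evalBound (P : Polynomial ℤ) {N n : ℕ} (hn : n ∈ Icc 1 N) :
    |P.eval (n : ℤ)| ≤ evalBound P N := by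
  have h : (P.eval (n : ℤ)).natAbs ≤ ∑ n ∈ Icc 1 N, (P.eval (n : ℤ)).natAbs :=
    single_le_sum (f := fun n : ℕ => (P.eval (n : ℤ)).natAbs) (fun _ _ => Nat.zero_le _) hn
  rw [Int.abs_eq_natAbs]
  unfold evalBound
  omega

/-- For suitable scales, all the averages along a sparse sequence are simultaneously close to the
exponential martingale with high probability. -/
lemma exists_scales (P : Polynomial ℤ) (hP : 0 < P.natDegree) {I : Set ℕ+} (hI : I.Infinite)
    (J : ℕ) (θ η : ℝ) (hη : 0 < η) :
    ∃ (N : ℕ → I) (M : ℕ → ℕ) (L : ℕ) (_ : NeZero L), StrictMono N ∧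
      𝔼 x : Phase L J, (if ∃ i ≤ J, η < ‖polyAverage (shift L J) P
        (fun y => expMart θ 0 (phaseSign M y)) (N i) x - expMart θ i (phaseSign M x)‖
        then (1 : ℝ) else 0) ≤ 1 / 4 := by
  classical
  -- D/K bounds the failure probability: Chebyshev for each of the J + 1 averages, then a union
  -- bound. The choice K > 4D makes it at most 1/4.
  set D : ℝ := (J + 1) * (1 / η ^ 2 * (8 * (J + 1) ^ 2 * (P.natDegree + 1))) with hD
  obtain ⟨K, hK⟩ := exists_nat_gt (4 * D)
  have hD0 : 0 ≤ D := by positivity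
  have hK0 : (0 : ℝ) < K := by linarith
  have hK0' : 0 < K := by exact_mod_cast hK0
  obtain ⟨N, hN, hsparse⟩ := exists_sparse_sequence hI (fun n => K * (K * evalBound P n))
  set M : ℕ → ℕ := fun j => K * evalBound P ((N j : ℕ+) : ℕ) with hM
  have hNmono : ∀ {i j}, i ≤ j → ((N i : ℕ+) : ℕ) ≤ ((N j : ℕ+) : ℕ) := fun h => hN.monotone h
  have hMmono : ∀ {i j}, i ≤ j → M i ≤ M j := fun h =>
    Nat.mul_le_mul_left _ (evalBound_mono P (hNmono h))
  -- The cycle is longer than any difference of two values of P plus a block, so no orbit segment in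
  -- use wraps around.
  set L : ℕ := 2 * evalBound P ((N J : ℕ+) : ℕ) + M J with hL
  have hev : ∀ n, 0 < evalBound P n := fun n => by unfold evalBound; omega
  have hLne : NeZero L := ⟨by have := hev ((N J : ℕ+) : ℕ); omega⟩
  refine ⟨N, M, L, hLne, hN, ?_⟩
  have hmain : ∀ i ∈ range (J + 1), 𝔼 x : Phase L J, ‖polyAverage (shift L J) P
      (fun y => expMart θ 0 (phaseSign M y)) (N i) x - expMart θ i (phaseSign M x)‖ ^ 2 ≤
        8 * (J + 1) ^ 2 * (P.natDegree + 1) / K := fun i hi => by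
    have hiJ : i ≤ J := by rw [mem_range] at hi; omega
    refine expect_polyAverage_expMart θ M K hK0 P hP (N i) i hiJ (fun j hj => ⟨?_, ?_⟩) ?_ ?_ ?_
    · exact Nat.mul_pos hK0' (hev _)
    · have := hMmono hj.le; omega
    · intro j hij _ n hn
      have h1 := (abs_eval_le_evalBound P hn).trans
        (by exact_mod_cast evalBound_mono P (hNmono hij) :
          (evalBound P ((N i : ℕ+) : ℕ) : ℤ) ≤ evalBound P ((N j : ℕ+) : ℕ))
      have h2 : |((P.eval (n : ℤ) : ℤ) : ℝ)| ≤ evalBound P ((N j : ℕ+) : ℕ) := by exact_mod_cast h1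
      rw [hM]
      push_cast
      gcongr
    · intro j hj
      have h1 := (hsparse j).trans (hNmono (Nat.succ_le_of_lt hj))
      exact_mod_cast h1
    · intro n hn n' hn' j hj
      have h1 := abs_eval_le_evalBound P hn
      have h2 := abs_eval_le_evalBound P hn'
      have h3 := abs_sub (P.eval (n : ℤ)) (P.eval (n' : ℤ))
      have h4 := evalBound_mono P (hNmono hiJ)
      have h5 := hMmono (hj.le.trans hiJ)
      rw [hL]
      push_cast
      omega
  have hpt : ∀ x : Phase L J, (if ∃ i ≤ J, η < ‖polyAverage (shift L J) P
      (fun y => expMart θ 0 (phaseSign M y)) (N i) x - expMart θ i (phaseSign M x)‖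
      then (1 : ℝ) else 0) ≤ ∑ i ∈ range (J + 1), 1 / η ^ 2 * ‖polyAverage (shift L J) P
      (fun y => expMart θ 0 (phaseSign M y)) (N i) x - expMart θ i (phaseSign M x)‖ ^ 2 :=
    fun x => by
    split_ifs with h
    · obtain ⟨i, hi, hlt⟩ := h
      refine le_trans ?_ (single_le_sum (f := fun i => 1 / η ^ 2 * ‖polyAverage (shift L J) P
        (fun y => expMart θ 0 (phaseSign M y)) (N i) x - expMart θ i (phaseSign M x)‖ ^ 2)
        (fun _ _ => by positivity) (mem_range.2 (Nat.lt_succ_of_le hi)))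
      rw [one_div_mul_eq_div, le_div_iff₀ (by positivity), one_mul]
      exact pow_le_pow_left₀ hη.le hlt.le 2
    · exact sum_nonneg (fun _ _ => by positivity)
  refine (expect_le_expect (fun x _ => hpt x)).trans ?_
  rw [expect_sum_comm]
  have hsum : ∀ i ∈ range (J + 1), 𝔼 x : Phase L J, 1 / η ^ 2 * ‖polyAverage (shift L J) P
      (fun y => expMart θ 0 (phaseSign M y)) (N i) x - expMart θ i (phaseSign M x)‖ ^ 2 ≤
        1 / η ^ 2 * (8 * (J + 1) ^ 2 * (P.natDegree + 1) / K) := fun i hi => by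
    rw [← mul_expect]
    gcongr
    exact hmain i hi
  refine (sum_le_sum hsum).trans ?_
  rw [sum_const, card_range, nsmul_eq_mul]
  calc ((J + 1 : ℕ) : ℝ) * (1 / η ^ 2 * (8 * (J + 1) ^ 2 * (P.natDegree + 1) / K)) = D / K := by
        rw [hD]; push_cast; ring
    _ ≤ 1 / 4 := by rw [div_le_iff₀ hK0]; linarith

end ErgodicVariation

open ErgodicVariation in
theorem mainTheorem7 (P : Polynomial ℤ) (hP : 0 < P.natDegree) (p : ℝ≥0∞) (hp : 0 < p)
    (I : Set ℕ+) (hI : I.Infinite) (C : ℝ≥0) :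
    ∃ (X : Type) (_ : MeasurableSpace X) (μ : Measure X) (T : X ≃ᵐ X),
      IsProbabilityMeasure μ ∧ MeasurePreserving T μ μ ∧
      ∃ f : X → ℂ, MemLp f ∞ μ ∧ eLpNorm f ∞ μ ≤ 1 ∧
        (C : ℝ≥0∞) < eLpVariation (fun N : I => polyAverage T.toEquiv P f (N : ℕ+)) p 2 μ := by
  classical
  obtain ⟨r, hr0, hr⟩ : ∃ r : ℝ, 0 ≤ r ∧
      (C : ℝ≥0∞) < ENNReal.ofReal r * (1 / 2) ^ (1 / p.toReal) := by
    set h : ℝ := (1 / 2) ^ (1 / p.toReal) with hh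
    have hpos : 0 < h := Real.rpow_pos_of_pos (by norm_num) _
    have he : ((1 / 2 : ℝ≥0∞)) ^ (1 / p.toReal) = ENNReal.ofReal h := by
      rw [hh, ← ENNReal.ofReal_rpow_of_pos (by norm_num), one_div (2 : ℝ),
        ENNReal.ofReal_inv_of_pos (by norm_num), ENNReal.ofReal_ofNat, one_div (2 : ℝ≥0∞)]
    refine ⟨(C + 1) / h, by positivity, ?_⟩
    rw [he, ← ENNReal.ofReal_mul (by positivity), div_mul_cancel₀ _ hpos.ne',
      ← ENNReal.ofReal_coe_nnreal]
    exact (ENNReal.ofReal_lt_ofReal_iff (by positivity)).2 (by linarith)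
  -- The squared variation will be at least (θ²/64)·C₀·J = C₀/64, which has to reach r².
  obtain ⟨C₀, hC₀⟩ := exists_nat_ge (64 * r ^ 2)
  obtain ⟨B, k, hB, hwalk⟩ := exists_blockVar_large C₀
  set l := B ^ k with hl
  have hl0 : 0 < l := Nat.pow_pos hB
  set m := 4 * l ^ 2 with hm
  have hwalk := hwalk m le_rfl
  set J := m * l with hJ
  have hJ0 : 0 < J := by positivity
  have hJr : (0 : ℝ) < J := by exact_mod_cast hJ0
  have hl1 : (1 : ℝ) ≤ l := by exact_mod_cast hl0
  set θ : ℝ := 1 / Real.sqrt J with hθ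
  have hθ0 : 0 < θ := by positivity
  have hθJ : θ ^ 2 * J = 1 := by
    rw [hθ, div_pow, Real.sq_sqrt hJr.le]; field_simp
  -- Since J = 4l³, (θl)² = 1/(4l): one window changes the phase by at most 1.
  have hθl : |θ| * l ≤ 1 := by
    rw [abs_of_pos hθ0]
    refine (abs_le_of_sq_le_sq' ?_ zero_le_one).2
    have hJl : (J : ℝ) = 4 * l ^ 3 := by rw [hJ, hm]; push_cast; ring
    rw [hJl] at hθJ
    have : (θ * l) ^ 2 * (4 * l) = 1 := by linear_combination hθJ
    nlinarith [sq_nonneg (θ * l)]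
  have hcos : 0 ≤ Real.cos θ := by
    have h1 := Real.one_sub_sq_div_two_le_cos (x := θ)
    have hθ1 : θ ≤ 1 := by
      rw [abs_of_pos hθ0] at hθl
      nlinarith
    nlinarith
  obtain ⟨N, M, L, hLne, hN, hclose⟩ := exists_scales P hP hI J θ (θ / 16) (by positivity)
  set f : Phase L J → ℂ := fun y => expMart θ 0 (phaseSign M y) with hf
  let bad₁ : Phase L J → Prop := fun x => ∑ i ∈ Finset.range m,
    blockVar B (sgn (phaseSign M x)) k (i * l) < C₀ * (J : ℕ)
  let bad₂ : Phase L J → Prop := fun x => ∃ i ≤ J, θ / 16 < ‖polyAverage (shift L J) P f (N i) x -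
    expMart θ i (phaseSign M x)‖
  refine exists_finite_system (shift L J) P p hp I C f (fun x => norm_expMart_le _ _ _)
    (Finset.univ.filter fun x => ¬ bad₁ x ∧ ¬ bad₂ x) ?_ r (fun x hx => ?_) hr
  · have h1 : Finset.expect Finset.univ (fun x : Phase L J => if bad₁ x then (1 : ℝ) else 0) ≤
        1 / 4 := by
      refine le_trans (le_of_eq ?_) hwalk
      exact expect_phaseSign M (fun ε => if ∑ i ∈ Finset.range m,
        blockVar B (sgn ε) k (i * l) < C₀ * (J : ℕ) then (1 : ℝ) else 0)
    have h2 : Finset.expect Finset.univ (fun x : Phase L J => if bad₂ x then (1 : ℝ) else 0) ≤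
        1 / 4 := hclose
    have h3 : ∀ x : Phase L J, (1 : ℝ) ≤ (if ¬ bad₁ x ∧ ¬ bad₂ x then (1 : ℝ) else 0) +
        ((if bad₁ x then (1 : ℝ) else 0) + (if bad₂ x then (1 : ℝ) else 0)) := fun x => by
      by_cases b1 : bad₁ x <;> by_cases b2 : bad₂ x <;> simp [b1, b2]
    have h4 := Finset.expect_le_expect (s := (Finset.univ : Finset (Phase L J))) (fun x _ => h3 x)
    rw [Finset.expect_add_distrib, Finset.expect_add_distrib, Fintype.expect_const] at h4
    have h5 : (1 / 2 : ℝ) ≤ Finset.expect Finset.univ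
        (fun x : Phase L J => if ¬ bad₁ x ∧ ¬ bad₂ x then (1 : ℝ) else 0) := by linarith
    rw [Fintype.expect_eq_sum_div_card, Finset.sum_boole, le_div_iff₀ (by
      exact_mod_cast Fintype.card_pos)] at h5
    have h6 : (Fintype.card (Phase L J) : ℝ) ≤
        2 * ((Finset.univ.filter fun x : Phase L J => ¬ bad₁ x ∧ ¬ bad₂ x).card : ℝ) := by linarith
    exact_mod_cast h6
  · obtain ⟨hb1, hb2⟩ := (Finset.mem_filter.1 hx).2
    simp only [bad₁, not_lt] at hb1
    simp only [bad₂, not_exists, not_and, not_lt] at hb2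
    have hv := le_rVariation_of_close
      (fun n : I => polyAverage (shift L J) P f (n : ℕ+) x) N hN.monotone hl.symm hθJ hcos hθl
      (phaseSign M x) (fun i hi => by rw [abs_of_pos hθ0]; exact hb2 i hi)
    refine le_trans (ENNReal.ofReal_le_ofReal (Real.le_sqrt_of_sq_le ?_)) hv
    have h7 : θ ^ 2 / 64 * (C₀ * J) = C₀ / 64 := by linear_combination (C₀ / 64 : ℝ) * hθJ
    have h8 := mul_le_mul_of_nonneg_left hb1 (show 0 ≤ θ ^ 2 / 64 by positivity)
    linarith
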